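/- Equip $\{1,3\}^{\mathbb Z}$ with the product topology and let $S$ be the shift, $(Sx)_n=x_{n+1}$. A sequence $x\in\{1,3\}^{\mathbb Z}$ is called differentiable if all its mono-symbol blocks (maximal constant runs) are finite and have length $1$ or $3$; its derivative $\Delta x\in\{1,3\}^{\mathbb Z}$ is then the sequence of lengths of its consecutive mono-symbol blocks, where $(\Delta x)_0$ is the length of the block containing $x_0$. It is called smooth if it is infinitely differentiable, that is, if every $\Delta^n x$ ($n\ge 0$) is well defined and differentiable. Let $X$ be the set of smooth sequences in $\{1,3\}^{\mathbb Z}$. For a differentiable $x$, let its recoding be the sequence over $\{A,B,C,D\}$ whose $k$-th term encodes the $k$-th mono-symbol block of $x$ (block $0$ being the one containing $x_0$), with $A=1$, $B=3$, $C=111$, $D=333$. A smooth $x$ is said to be of type $0$ if its recoding contains one of the words $ABA$, $DCD$, and of type $1$ if its recoding contains one of the words $BAB$, $CDC$. For $\tau=(\tau_n)_{n\ge0}\in\{0,1\}^{\mathbb N}$, let $X_\tau$ be the set of all $x\in X$ such that $\Delta^n x$ is of type $\tau_n$ for every $n\ge 0$. For a finite word $w=w_0\cdots w_{\ell-1}$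 over $\{1,3\}$ let $[w]=\{x\in\{1,3\}^{\mathbb Z}: x_i=w_i \text{ for } 0\le i<\ell\}$, and let $|x_0\cdots x_{n-1}|_w$ be the number of occurrences of $w$ in $x_0\cdots x_{n-1}$. **Theorem.** For every $\tau\in\{0,1\}^{\mathbb N}$, the set $X_\tau$ is a subshift (it is nonempty and closed, and $S(X_\tau)=X_\tau$), and it is uniquely ergodic: there is exactly one $S$-invariant Borel probability measure $\mu_\tau$ on $X_\tau$. The sets $X_\tau$, $\tau\in\{0,1\}^{\mathbb N}$, are pairwise disjoint and their union is $X$. Moreover, for every $\tau$, every $x\in X_\tau$ and every finite word $w$ over $\{1,3\}$, the frequency of $w$ in $x$ exists and depends only on $w$ and $\tau$; precisely, $$\lim_{n\to\infty}\frac{|x_0\cdots x_{n-1}|_w}{n}=\mu_\tau([w]).$$ -/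

import Mathlib

open MeasureTheory Filter Topology

noncomputable section

namespace SmoothSeq

/-- The alphabet `{1, 3}`, with the discrete topology and the discrete `σ`-algebra. -/
abbrev Letter : Type := ({1, 3} : Finset ℕ)

/-- The letter `1`. -/
def one : Letter := ⟨1, by simp⟩

/-- The letter `3`. -/
def three : Letter := ⟨3, by simp⟩

/-- Bi-infinite sequences over `{1, 3}`, with the product topology and the product `σ`-algebra
(which is the Borel `σ`-algebra). -/
abbrev BiSeq : Type := ℤ → Letter

/-- The shift map, `(S x)_n = x_{n+1}`. -/
def shift (x : BiSeq) : BiSeq := fun n => x (n + 1)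

/-- `b k` is the starting index of the `k`-th mono-symbol block (maximal constant run) of `x`,
the blocks being numbered from left to right in such a way that block `0` contains the index `0`.
In particular every mono-symbol block of `x` is finite. -/
structure IsBlockStarts (x : BiSeq) (b : ℤ → ℤ) : Prop where
  strictMono : StrictMono b
  zero_le : b 0 ≤ 0
  zero_lt : 0 < b 1
  const : ∀ k i, b k ≤ i → i < b (k + 1) → x i = x (b k)
  change : ∀ k, x (b (k + 1)) ≠ x (b k)

namespace IsBlockStarts

variable {x : BiSeq} {b c : ℤ → ℤ}

theorem inner (hb : IsBlockStarts x b) (k i : ℤ) (h1 : b k < i) (h2 : i < b (k + 1)) :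
    x i = x (i - 1) := by
  rw [hb.const k i h1.le h2, hb.const k (i - 1) (by omega) (by omega)]

theorem jump (hb : IsBlockStarts x b) (k : ℤ) : x (b k) ≠ x (b k - 1) := by
  have h := hb.change (k - 1)
  have h1 : b (k - 1) < b k := hb.strictMono (by omega)
  have h2 := hb.const (k - 1) (b k - 1) (by omega) (by rw [sub_add_cancel]; omega)
  rw [sub_add_cancel] at h
  rwa [h2]

theorem zero_not_lt (hb : IsBlockStarts x b) (hc : IsBlockStarts x c) : ¬ b 0 < c 0 := fun h =>
  hc.jump 0 (hb.inner 0 (c 0) h (by have := hc.zero_le; have := hb.zero_lt; simpa using by omega))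

theorem succ_not_lt (hb : IsBlockStarts x b) (hc : IsBlockStarts x c) (k : ℤ) (h : b k = c k) :
    ¬ b (k + 1) < c (k + 1) := fun h' =>
  hb.jump (k + 1) (hc.inner k _ (by rw [← h]; exact hb.strictMono (by omega)) h')

theorem pred_not_lt (hb : IsBlockStarts x b) (hc : IsBlockStarts x c) (k : ℤ) (h : b k = c k) :
    ¬ b (k - 1) < c (k - 1) := fun h' =>
  hc.jump (k - 1) (hb.inner (k - 1) _ h' (by
    rw [sub_add_cancel, h]; exact hc.strictMono (by omega)))

/-- The block decomposition is unique. -/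
theorem unique (hb : IsBlockStarts x b) (hc : IsBlockStarts x c) : b = c := by
  funext k
  induction k using Int.induction_on with
  | zero => have := hb.zero_not_lt hc; have := hc.zero_not_lt hb; omega
  | succ k ih =>
    have := hb.succ_not_lt hc k ih; have := hc.succ_not_lt hb k ih.symm; omega
  | pred k ih =>
    have := hb.pred_not_lt hc _ ih; have := hc.pred_not_lt hb _ ih.symm; omega

end IsBlockStarts

open scoped Classical in
/-- The starting indices of the mono-symbol blocks of `x` (junk value if `x` has no decomposition
into finite mono-symbol blocks). -/
def blockStart (x : BiSeq) : ℤ → ℤ := if h : ∃ b, IsBlockStarts x b then h.choose else id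

theorem blockStart_eq {x : BiSeq} {b : ℤ → ℤ} (hb : IsBlockStarts x b) : blockStart x = b := by
  have h : ∃ b, IsBlockStarts x b := ⟨b, hb⟩
  rw [blockStart, dif_pos h]
  exact h.choose_spec.unique hb

/-- `x` is differentiable: its mono-symbol blocks are all finite, with lengths in `{1, 3}`. -/
def IsDifferentiable (x : BiSeq) : Prop :=
  ∃ b, IsBlockStarts x b ∧ ∀ k, b (k + 1) - b k = 1 ∨ b (k + 1) - b k = 3

/-- The derivative `Δ x` of a differentiable sequence: `(Δ x)_k` is the length of the `k`-th
mono-symbol block of `x`, block `0` being the one that contains `x_0`. -/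
def derivative (x : BiSeq) : BiSeq := fun k =>
  if blockStart x (k + 1) - blockStart x k = 1 then one else three

/-- `x` is smooth: it is infinitely differentiable. -/
def IsSmooth (x : BiSeq) : Prop := ∀ n : ℕ, IsDifferentiable (derivative^[n] x)

/-- The set `X` of all bi-infinite smooth sequences over `{1, 3}`. -/
def X : Set BiSeq := {x | IsSmooth x}

/-- The alphabet used to recode mono-symbol blocks: `A = 1`, `B = 3`, `C = 111`, `D = 333`. -/
inductive Block : Type
  | A
  | B
  | C
  | D

/-- The recoding of a differentiable sequence: the `k`-th term encodes the `k`-th mono-symbol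
block of `x`. -/
def recode (x : BiSeq) : ℤ → Block := fun k =>
  if x (blockStart x k) = one then
    if derivative x k = one then Block.A else Block.C
  else
    if derivative x k = one then Block.B else Block.D

/-- The three-letter word `u v w` is a factor of `y`. -/
def HasFactor (y : ℤ → Block) (u v w : Block) : Prop :=
  ∃ k, y k = u ∧ y (k + 1) = v ∧ y (k + 2) = w

/-- `x` is of type `t`: its recoding contains an elementary block among `ABA`, `DCD` if `t = 0`,
among `BAB`, `CDC` if `t = 1`. (In the recoding of a smooth sequence, these words are elementary
blocks wherever they occur, because the blocks of the derivative have length at most `3`.) -/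
def HasType (x : BiSeq) (t : Fin 2) : Prop :=
  (t = 0 ∧ (HasFactor (recode x) .A .B .A ∨ HasFactor (recode x) .D .C .D)) ∨
  (t = 1 ∧ (HasFactor (recode x) .B .A .B ∨ HasFactor (recode x) .C .D .C))

/-- The set `X_τ` of smooth bi-infinite sequences with type sequence `τ`: for every `n`, the
`n`-th derivative is of type `τ_n`. -/
def Xtype (τ : ℕ → Fin 2) : Set BiSeq :=
  {x | x ∈ X ∧ ∀ n : ℕ, HasType (derivative^[n] x) (τ n)}

/-- A subshift: a nonempty closed set `Z` of bi-infinite sequences with `S(Z) = Z`. -/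
def IsSubshift (Z : Set BiSeq) : Prop :=
  Z.Nonempty ∧ IsClosed Z ∧ shift '' Z = Z

/-- The shift-invariant Borel probability measures on `Z`, viewed as measures on the space of all
bi-infinite sequences that are carried by `Z`. -/
def invariantProbabilityMeasures (Z : Set BiSeq) : Set (Measure BiSeq) :=
  {μ | IsProbabilityMeasure μ ∧ μ Zᶜ = 0 ∧ MeasurePreserving shift μ μ}

/-- The cylinder set `[w]` of a finite word `w`. -/
def cylinder (w : List Letter) : Set BiSeq :=
  {x | ∀ (i : ℕ) (h : i < w.length), x i = w[i]}

open scoped Classical in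
/-- The number `|x_0 ⋯ x_{n-1}|_w` of occurrences of the word `w` in the prefix of length `n`. -/
def occurrences (x : BiSeq) (w : List Letter) (n : ℕ) : ℕ :=
  ((Finset.range (n + 1)).filter fun i =>
    i + w.length ≤ n ∧ ∀ (k : ℕ) (h : k < w.length), x (i + k) = w[k]).card

/-- The frequency of occurrence of the word `w` in `x` exists and equals `f`. -/
def HasFrequency (x : BiSeq) (w : List Letter) (f : ℝ) : Prop :=
  Tendsto (fun n : ℕ => (occurrences x w n : ℝ) / n) atTop (𝓝 f)

end SmoothSeq

end

namespace SmoothSeq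

/-! Types. Runs of a differentiable sequence alternate in letter and have odd length. Move along the
starts of the runs of Δx: the letter of Δx changes at each of them, and so does the letter of the
run of x measured there, because an odd number of runs of x has been passed. The two letters are
therefore always equal or always opposite, and this single bit is the type (`letter_alternates`). A
smooth sequence together with its derivatives is thus a tower (`IsTower`) with exactly one type
sequence, which gives the partition of `X`. Conversely, a primitive of either type exists
(`exists_primitive`), so towers of any finite height exist for every τ, and compactness supplies
infinite ones.

Frequencies. Group the runs of the n-th derivative into consecutive pairs. The word of the bottom
sequence coded by such a pair depends only on its first letter and its two lengths (`agree_pair`).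
Two consecutive runs e…e ē…ē of the next derivative have even total length, so they split into
level-n pairs (e,e), (e,ē), (ē,ē), all with the same first letter; the outer pairs are present only
next to a run of length 3, and the middle one always is. The inequalities on lengths show that the
middle pair fills at least 1/6 of the whole. Hence the range of densities of w in level-n pairs
shrinks by the factor 5/6 at each level, up to a boundary error of order |w|/n
(`DensityBetween.succ`), so it collapses to one number, common to all points of X_τ.

Measures. Integrating Birkhoff averages of an indicator shows that every invariant probability
measure on X_τ gives [w] the mass of this frequency, and cylinders determine an invariant measure.
Existence is the Krylov–Bogoliubov theorem on the compact set X_τ. -/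

/-- The involution of the alphabet exchanging `1` and `3`. -/
def swap (a : Letter) : Letter := if a = one then three else one

theorem eq_one_or_three (a : Letter) : a = one ∨ a = three := by
  obtain ⟨a, ha⟩ := a
  simp only [Finset.mem_insert, Finset.mem_singleton] at ha
  rcases ha with rfl | rfl
  · exact Or.inl rfl
  · exact Or.inr rfl

@[simp] theorem three_ne_one : (three = one) ↔ False := by decide

@[simp] theorem one_eq_three : (one = three) ↔ False := by decide

@[simp] theorem swap_one : swap one = three := by decide

@[simp] theorem swap_three : swap three = one := by decide

@[simp] theorem swap_swap (a : Letter) : swap (swap a) = a := by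
  rcases eq_one_or_three a with rfl | rfl <;> simp

theorem swap_ne (a : Letter) : swap a ≠ a := by
  rcases eq_one_or_three a with rfl | rfl <;> simp

theorem eq_swap_of_ne {a c : Letter} (h : a ≠ c) : a = swap c := by
  rcases eq_one_or_three a with rfl | rfl <;> rcases eq_one_or_three c with rfl | rfl <;>
    simp at h ⊢

theorem val_one : ((one : Letter) : ℕ) = 1 := rfl

theorem val_three : ((three : Letter) : ℕ) = 3 := rfl

theorem val_eq (a : Letter) : (a : ℕ) = 1 ∨ (a : ℕ) = 3 := by
  rcases eq_one_or_three a with rfl | rfl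
  · exact Or.inl rfl
  · exact Or.inr rfl

/-- The permutation of the alphabet attached to a type: the identity for type `0`, the exchange
of the two letters for type `1`. -/
def twist (t : Fin 2) (a : Letter) : Letter := if t = 0 then a else swap a

@[simp] theorem twist_swap (t : Fin 2) (a : Letter) : twist t (swap a) = swap (twist t a) := by
  unfold twist; split_ifs <;> simp

theorem twist_left_injective {t u : Fin 2} {a : Letter} (h : twist t a = twist u a) : t = u := by
  fin_cases t <;> fin_cases u <;> simp [twist, swap_ne, (swap_ne _).symm] at h ⊢

/-! ### Integer sequences with prescribed increments -/

theorem exists_int_sum (d : ℤ → ℤ) : ∃ H : ℤ → ℤ, H 0 = 0 ∧ ∀ k, H (k + 1) = H k + d k := by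
  refine ⟨fun k => (∑ i ∈ Finset.range k.toNat, d i) -
    ∑ i ∈ Finset.range (-k).toNat, d (-(i : ℤ) - 1), by simp, fun k => ?_⟩
  rcases le_or_gt 0 k with h | h
  · lift k to ℕ using h
    have h1 : ((k : ℤ) + 1).toNat = k + 1 := by omega
    have h2 : (-((k : ℤ) + 1)).toNat = 0 := by omega
    have h3 : (-(k : ℤ)).toNat = 0 := by omega
    simp only [h1, h2, h3, Int.toNat_natCast, Finset.sum_range_succ, Finset.range_zero,
      Finset.sum_empty]
    ring
  · obtain ⟨m, rfl⟩ : ∃ m : ℕ, k = -(m : ℤ) - 1 := ⟨(-k - 1).toNat, by omega⟩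
    have h1 : (-(m : ℤ) - 1 + 1).toNat = 0 := by omega
    have h2 : (-(-(m : ℤ) - 1 + 1)).toNat = m := by omega
    have h3 : (-(m : ℤ) - 1).toNat = 0 := by omega
    have h4 : (-(-(m : ℤ) - 1)).toNat = m + 1 := by omega
    simp only [h1, h2, h3, h4, Finset.sum_range_succ, Finset.range_zero, Finset.sum_empty]
    ring

theorem exists_between_of_strictMono {b : ℤ → ℤ} (hb : StrictMono b) (i : ℤ) :
    ∃ k, b k ≤ i ∧ i < b (k + 1) := by
  have hup : ∀ n : ℕ, b 0 + n ≤ b n := fun n => by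
    induction n with
    | zero => simp
    | succ n ih => have := hb (show (n : ℤ) < n + 1 by omega); push_cast; omega
  have hdn : ∀ n : ℕ, b (-n) ≤ b 0 - n := fun n => by
    induction n with
    | zero => simp
    | succ n ih =>
      have := hb (show -((n + 1 : ℕ) : ℤ) < -(n : ℤ) by push_cast; omega); push_cast at *; omega
  obtain ⟨k, hk, hk'⟩ := Int.exists_greatest_of_bdd (P := fun k => b k ≤ i)
    ⟨(i - b 0).toNat + 1, fun z hz => by
      by_contra! h
      have h1 := hup ((i - b 0).toNat + 1)
      have h2 := hb h
      push_cast at h1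
      omega⟩
    ⟨-((b 0 - i).toNat : ℤ), by have := hdn (b 0 - i).toNat; omega⟩
  exact ⟨k, hk, by by_contra! h; have := hk' _ h; omega⟩

theorem eq_of_between {b : ℤ → ℤ} (hb : StrictMono b) {i k l : ℤ} (h1 : b k ≤ i)
    (h2 : i < b (k + 1)) (h3 : b l ≤ i) (h4 : i < b (l + 1)) : k = l := by
  have := hb.lt_iff_lt.1 (h1.trans_lt h4)
  have := hb.lt_iff_lt.1 (h3.trans_lt h2)
  omega

/-! ### Block decompositions -/

theorem IsBlockStarts.succ_eq_swap {x : BiSeq} {b : ℤ → ℤ} (h : IsBlockStarts x b) (k : ℤ) :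
    x (b (k + 1)) = swap (x (b k)) := eq_swap_of_ne (h.change k)

theorem IsBlockStarts.add_two {x : BiSeq} {b : ℤ → ℤ} (h : IsBlockStarts x b) (k : ℤ) :
    x (b (k + 2)) = x (b k) := by
  rw [show k + 2 = k + 1 + 1 by ring, h.succ_eq_swap, h.succ_eq_swap, swap_swap]

theorem blockStart_spec {x : BiSeq} (h : IsDifferentiable x) :
    IsBlockStarts x (blockStart x) ∧
      ∀ k, blockStart x (k + 1) - blockStart x k = ((derivative x k : ℕ) : ℤ) := by
  obtain ⟨b, hb, hl⟩ := h
  refine ⟨blockStart_eq hb ▸ hb, fun k => ?_⟩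
  unfold derivative
  rw [blockStart_eq hb]
  rcases hl k with h | h <;> simp [h, val_one, val_three]

theorem isDifferentiable_of {x y : BiSeq} {b : ℤ → ℤ} (hb : IsBlockStarts x b)
    (hl : ∀ k, b (k + 1) - b k = ((y k : ℕ) : ℤ)) : IsDifferentiable x ∧ derivative x = y := by
  refine ⟨⟨b, hb, fun k => ?_⟩, funext fun k => ?_⟩
  · rw [hl]; rcases val_eq (y k) with h | h <;> simp [h]
  · unfold derivative
    rw [blockStart_eq hb, hl]
    rcases eq_one_or_three (y k) with h | h <;> simp [h, val_one, val_three]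

/-! ### Towers of successive derivatives -/

/-- A tower of successive derivatives with type sequence `τ`: `x (n + 1)` is the derivative of
`x n`, whose mono-symbol blocks start at the indices `b n k`. -/
structure IsTower (τ : ℕ → Fin 2) (x : ℕ → BiSeq) (b : ℕ → ℤ → ℤ) : Prop where
  blocks : ∀ n, IsBlockStarts (x n) (b n)
  len : ∀ n k, b n (k + 1) - b n k = ((x (n + 1) k : ℕ) : ℤ)
  letter : ∀ n j, x n (b n (b (n + 1) j)) = twist (τ n) (x (n + 1) (b (n + 1) j))

namespace IsTower

variable {τ : ℕ → Fin 2} {x : ℕ → BiSeq} {b : ℕ → ℤ → ℤ}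

theorem iterate_eq (h : IsTower τ x b) (n : ℕ) : derivative^[n] (x 0) = x n := by
  induction n with
  | zero => rfl
  | succ n ih =>
    rw [Function.iterate_succ_apply', ih, (isDifferentiable_of (h.blocks n) (h.len n)).2]

theorem isDifferentiable (h : IsTower τ x b) (n : ℕ) : IsDifferentiable (x n) :=
  (isDifferentiable_of (h.blocks n) (h.len n)).1

theorem mem_X (h : IsTower τ x b) : x 0 ∈ X := fun n => h.iterate_eq n ▸ h.isDifferentiable n

theorem exists_eq_three (h : IsTower τ x b) (n : ℕ) : ∃ j, x n j = three := by
  have h0 := (h.blocks n).succ_eq_swap 0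
  rcases eq_one_or_three (x n (b n 0)) with h1 | h1
  · exact ⟨_, by rw [h0, h1, swap_one]⟩
  · exact ⟨_, h1⟩

theorem recode_eq (h : IsTower τ x b) (n : ℕ) (k : ℤ) :
    recode (x n) k = if x n (b n k) = one then (if x (n + 1) k = one then .A else .C)
      else (if x (n + 1) k = one then .B else .D) := by
  unfold recode
  rw [blockStart_eq (h.blocks n), (isDifferentiable_of (h.blocks n) (h.len n)).2]

/-- A run has at most three letters, so three equal consecutive letters fill a whole run. -/
theorem start_of_three (h : IsTower τ x b) {n : ℕ} {k : ℤ} (h1 : x n (k + 1) = x n k)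
    (h2 : x n (k + 2) = x n k) : ∃ j, b n j = k := by
  obtain ⟨j, hj, hj'⟩ := exists_between_of_strictMono (h.blocks n).strictMono k
  have hl := h.len n j
  have hc := h.blocks n |>.const j k hj hj'
  have hs := h.blocks n |>.change j
  refine ⟨j, ?_⟩
  by_contra hne
  rcases val_eq (x (n + 1) j) with h3 | h3
  · rw [h3] at hl; push_cast at hl; omega
  · rw [h3] at hl; push_cast at hl
    rcases (by omega : b n (j + 1) = k + 1 ∨ b n (j + 1) = k + 2) with h4 | h4
    · rw [h4, h1, hc] at hs; exact hs rfl
    · rw [h4, h2, hc] at hs; exact hs rfl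

/-- Links the types defined by words of the recoding to the bit of the tower: these words are
exactly what the recoding shows over a run of length 3 of the derivative, and the tower relation
compares the two letters at the start of that run. -/
theorem hasType_iff (h : IsTower τ x b) (n : ℕ) (t : Fin 2) : HasType (x n) t ↔ t = τ n := by
  have key : ∀ u v w : Block, HasFactor (recode (x n)) u v w →
      (u = .A ∧ v = .B ∧ w = .A ∨ u = .D ∧ v = .C ∧ w = .D) ∨
      (u = .B ∧ v = .A ∧ w = .B ∨ u = .C ∧ v = .D ∧ w = .C) →
      ∃ j, b (n + 1) j ∈ {k | recode (x n) k = u ∧ recode (x n) (k + 1) = v} := by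
    rintro u v w ⟨k, hu, hv, hw⟩ hc
    have : x (n + 1) (k + 1) = x (n + 1) k ∧ x (n + 1) (k + 2) = x (n + 1) k := by
      rw [h.recode_eq] at hu hv hw
      rcases eq_one_or_three (x (n + 1) k) with h0 | h0 <;>
      rcases eq_one_or_three (x (n + 1) (k + 1)) with h1 | h1 <;>
      rcases eq_one_or_three (x (n + 1) (k + 2)) with h2 | h2 <;>
      simp only [h0, h1, h2, if_true, three_ne_one, if_false, one_eq_three, and_self]
        at hu hv hw ⊢ <;>
      exfalso <;> subst hu hv hw <;> revert hc <;> split_ifs <;> simp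
    obtain ⟨j, hj⟩ := h.start_of_three this.1 this.2
    exact ⟨j, by rw [hj]; exact ⟨hu, hv⟩⟩
  -- Some block of level `n + 1` has length 3, since both letters occur in `x (n + 2)`.
  have conv : ∃ k, x (n + 1) (k + 1) = x (n + 1) k ∧ x (n + 1) (k + 2) = x (n + 1) k ∧
      x n (b n k) = twist (τ n) (x (n + 1) k) := by
    obtain ⟨j, hj⟩ := h.exists_eq_three (n + 2)
    have hl := h.len (n + 1) j
    rw [hj, val_three] at hl
    push_cast at hl
    exact ⟨b (n + 1) j, (h.blocks (n + 1)).const j _ (by omega) (by omega),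
      (h.blocks (n + 1)).const j _ (by omega) (by omega), h.letter n j⟩
  constructor
  · intro ht
    have : ∃ j, x n (b n (b (n + 1) j)) = twist t (x (n + 1) (b (n + 1) j)) := by
      rcases ht with ⟨rfl, hf | hf⟩ | ⟨rfl, hf | hf⟩ <;>
      obtain ⟨j, hj, -⟩ := key _ _ _ hf (by simp) <;> refine ⟨j, ?_⟩ <;>
      rw [h.recode_eq] at hj <;>
      rcases eq_one_or_three (x n (b n (b (n + 1) j))) with h0 | h0 <;>
      rcases eq_one_or_three (x (n + 1) (b (n + 1) j)) with h1 | h1 <;>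
      simp_all [twist]
    obtain ⟨j, hj⟩ := this
    rw [h.letter] at hj
    exact (twist_left_injective hj).symm
  · rintro rfl
    obtain ⟨k, h1, h2, h3⟩ := conv
    have h4 := (h.blocks n).succ_eq_swap k
    have h5 := (h.blocks n).add_two k
    have e0 := h.recode_eq n k
    have e1 := h.recode_eq n (k + 1)
    have e2 := h.recode_eq n (k + 2)
    rw [h4, h1, h3] at e1
    rw [h5, h2, h3] at e2
    rw [h3] at e0
    unfold HasType HasFactor
    generalize τ n = t at *
    rcases eq_one_or_three (x (n + 1) k) with h0 | h0 <;> rw [h0] at e0 e1 e2 <;>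
      fin_cases t <;> simp [twist] at e0 e1 e2 ⊢
    · exact Or.inl ⟨k, e0, e1, e2⟩
    · exact Or.inl ⟨k, e0, e1, e2⟩
    · exact Or.inr ⟨k, e0, e1, e2⟩
    · exact Or.inr ⟨k, e0, e1, e2⟩

end IsTower

/-- Both sides change letter when `j` increases by one, the left side because an odd number of
blocks of `x` is crossed. One index therefore decides for all. -/
theorem letter_alternates {x y : BiSeq} {b c : ℤ → ℤ} (hx : IsBlockStarts x b)
    (hc : IsBlockStarts y c) (hl : ∀ j, c (j + 1) - c j = 1 ∨ c (j + 1) - c j = 3) (t : Fin 2)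
    (h0 : x (b (c 0)) = twist t (y (c 0))) (j : ℤ) : x (b (c j)) = twist t (y (c j)) := by
  have step : ∀ j, x (b (c (j + 1))) = swap (x (b (c j))) := fun j => by
    rcases hl j with h | h
    · rw [show c (j + 1) = c j + 1 by omega, hx.succ_eq_swap]
    · rw [show c (j + 1) = c j + 2 + 1 by omega, hx.succ_eq_swap, hx.add_two]
  have step' : ∀ j, x (b (c (j + 1))) = twist t (y (c (j + 1))) ↔
      x (b (c j)) = twist t (y (c j)) := fun j => by
    rw [step, hc.succ_eq_swap, twist_swap]
    exact ⟨fun h => by simpa using congrArg swap h, fun h => by rw [h]⟩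
  induction j using Int.induction_on with
  | zero => exact h0
  | succ k ih => exact (step' _).2 ih
  | pred k ih => exact (step' _).1 (by rwa [sub_add_cancel])

theorem exists_isTower {x : BiSeq} (hx : x ∈ X) :
    ∃ τ, IsTower τ (fun n => derivative^[n] x) (fun n => blockStart (derivative^[n] x)) := by
  have hs : ∀ n, _ := fun n => blockStart_spec (hx n)
  have : ∀ n, ∃ t, derivative^[n] x (blockStart (derivative^[n] x)
      (blockStart (derivative^[n + 1] x) 0)) =
        twist t (derivative^[n + 1] x (blockStart (derivative^[n + 1] x) 0)) := fun n => by
    by_cases h : derivative^[n] x (blockStart (derivative^[n] x)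
      (blockStart (derivative^[n + 1] x) 0)) =
        derivative^[n + 1] x (blockStart (derivative^[n + 1] x) 0)
    · exact ⟨0, h⟩
    · exact ⟨1, by simpa [twist] using eq_swap_of_ne h⟩
  choose τ hτ using this
  refine ⟨τ, fun n => (hs n).1, fun n k => ?_, fun n j => ?_⟩
  · simp only [Function.iterate_succ_apply']
    exact (hs n).2 k
  · refine letter_alternates (hs n).1 (hs (n + 1)).1 (fun j => ?_) _ (hτ n) j
    rw [(hs (n + 1)).2]
    exact_mod_cast val_eq _

theorem mem_Xtype_iff {τ : ℕ → Fin 2} {x : BiSeq} :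
    x ∈ Xtype τ ↔ ∃ xs bs, IsTower τ xs bs ∧ xs 0 = x := by
  constructor
  · rintro ⟨hx, ht⟩
    obtain ⟨σ, hσ⟩ := exists_isTower hx
    obtain rfl : τ = σ := funext fun n => (hσ.hasType_iff n _).1 (ht n)
    exact ⟨_, _, hσ, rfl⟩
  · rintro ⟨xs, bs, h, rfl⟩
    exact ⟨h.mem_X, fun n => by rw [h.iterate_eq]; exact (h.hasType_iff n _).2 rfl⟩

theorem X_eq_iUnion_Xtype : X = ⋃ τ : ℕ → Fin 2, Xtype τ := by
  ext x
  simp only [Set.mem_iUnion]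
  refine ⟨fun hx => ?_, fun ⟨τ, h⟩ => h.1⟩
  obtain ⟨τ, h⟩ := exists_isTower hx
  exact ⟨τ, mem_Xtype_iff.2 ⟨_, _, h, rfl⟩⟩

theorem pairwise_disjoint_Xtype :
    Pairwise (fun τ τ' : ℕ → Fin 2 => Disjoint (Xtype τ) (Xtype τ')) := by
  intro τ τ' hne
  refine Set.disjoint_left.2 fun x h h' => hne ?_
  obtain ⟨σ, hσ⟩ := exists_isTower h.1
  exact funext fun n => ((hσ.hasType_iff n _).1 (h.2 n)).trans
    ((hσ.hasType_iff n _).1 (h'.2 n)).symm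

/-! ### Shift invariance -/

/-- Translation of a sequence by an integer. -/
def translate (s : ℤ) (x : BiSeq) : BiSeq := fun k => x (k + s)

theorem IsBlockStarts.translate {x : BiSeq} {b : ℤ → ℤ} (h : IsBlockStarts x b) {s u : ℤ}
    (h1 : b u ≤ s) (h2 : s < b (u + 1)) :
    IsBlockStarts (translate s x) (fun k => b (k + u) - s) where
  strictMono k l hkl := by
    have := h.strictMono (show k + u < l + u by omega)
    change b (k + u) - s < b (l + u) - s
    omega
  zero_le := by simpa using h1
  zero_lt := by rw [add_comm 1 u]; omega
  const k i hi hi' := by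
    have := h.const (k + u) (i + s) (by omega) (by
      rw [show k + u + 1 = k + 1 + u by ring]; omega)
    simpa [SmoothSeq.translate] using this
  change k := by
    have := h.change (k + u)
    rw [show k + u + 1 = k + 1 + u by ring] at this
    simpa [SmoothSeq.translate] using this

/-- Translating level `n` by `u n` translates level `n + 1` by the index of the block containing `u
n`, so that block 0 again contains the origin. -/
theorem IsTower.exists_translate {τ : ℕ → Fin 2} {x : ℕ → BiSeq} {b : ℕ → ℤ → ℤ}
    (h : IsTower τ x b) (s : ℤ) : ∃ x' b', IsTower τ x' b' ∧ x' 0 = translate s (x 0) := by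
  choose f hf hf' using fun n => exists_between_of_strictMono (h.blocks n).strictMono
  let u : ℕ → ℤ := fun n => Nat.rec s (fun n s => f n s) n
  have hu : ∀ n, u (n + 1) = f n (u n) := fun n => rfl
  refine ⟨fun n => translate (u n) (x n), fun n k => b n (k + u (n + 1)) - u n,
    ⟨fun n => (h.blocks n).translate (by rw [hu]; exact hf _ _) (by rw [hu]; exact hf' _ _),
      fun n k => ?_, fun n j => ?_⟩, rfl⟩
  · have := h.len n (k + u (n + 1))
    rw [show k + u (n + 1) + 1 = k + 1 + u (n + 1) by ring] at this
    simp only [translate]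
    omega
  · simpa [translate] using h.letter n (j + u (n + 1 + 1))

theorem translate_mem_Xtype {τ : ℕ → Fin 2} {x : BiSeq} (hx : x ∈ Xtype τ) (s : ℤ) :
    translate s x ∈ Xtype τ := by
  obtain ⟨xs, bs, h, rfl⟩ := mem_Xtype_iff.1 hx
  obtain ⟨x', b', h', h0⟩ := h.exists_translate s
  exact mem_Xtype_iff.2 ⟨x', b', h', h0⟩

theorem shift_mem_Xtype {τ : ℕ → Fin 2} {x : BiSeq} (hx : x ∈ Xtype τ) : shift x ∈ Xtype τ :=
  translate_mem_Xtype hx 1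

theorem shift_image_Xtype (τ : ℕ → Fin 2) : shift '' Xtype τ = Xtype τ := by
  ext x
  constructor
  · rintro ⟨y, hy, rfl⟩
    exact shift_mem_Xtype hy
  · exact fun hx => ⟨translate (-1) x, translate_mem_Xtype hx _, by
      funext k; simp [shift, translate]⟩

/-! ### Primitives -/

theorem abs_le_of_increments {b : ℤ → ℤ} {C : ℤ} (h0 : |b 0| ≤ C)
    (hl : ∀ k, b (k + 1) - b k = 1 ∨ b (k + 1) - b k = 3) (k : ℤ) : |b k| ≤ 3 * |k| + C := by
  have hk : |b k - b 0| ≤ 3 * |k| := by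
    induction k using Int.induction_on with
    | zero => simp
    | succ k ih =>
      rw [abs_of_nonneg (by omega : (0 : ℤ) ≤ k)] at ih
      rw [abs_of_nonneg (by omega : (0 : ℤ) ≤ (k : ℤ) + 1)]
      have := hl k
      rw [abs_le] at *
      omega
    | pred k ih =>
      rw [abs_of_nonpos (by omega : -(k : ℤ) ≤ 0)] at ih
      rw [abs_of_nonpos (by omega : -(k : ℤ) - 1 ≤ 0)]
      have := hl (-(k : ℤ) - 1)
      rw [sub_add_cancel] at this
      rw [abs_le] at *
      omega
  rw [abs_le] at *
  omega

theorem exists_primitive {y : BiSeq} {c : ℤ → ℤ} (hc : IsBlockStarts y c)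
    (hl : ∀ j, c (j + 1) - c j = 1 ∨ c (j + 1) - c j = 3) (t : Fin 2) :
    ∃ (x : BiSeq) (b : ℤ → ℤ), IsBlockStarts x b ∧ b 0 = 0 ∧
      (∀ k, b (k + 1) - b k = ((y k : ℕ) : ℤ)) ∧ ∀ j, x (b (c j)) = twist t (y (c j)) := by
  obtain ⟨b, hb0, hb⟩ := exists_int_sum fun k => ((y k : ℕ) : ℤ)
  have hmono : StrictMono b := strictMono_int_of_lt_succ fun k => by
    have := val_eq (y k); rw [hb]; omega
  choose f hf hf' using exists_between_of_strictMono hmono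
  have hfb : ∀ k i, b k ≤ i → i < b (k + 1) → f i = k := fun k i h1 h2 =>
    eq_of_between hmono (hf i) (hf' i) h1 h2
  have hfb' : ∀ k, f (b k) = k := fun k => hfb k _ le_rfl (hmono (by omega))
  -- The lengths determine the primitive up to exchanging the two letters; this choice realises the
  -- type at `c 0`, and alternation propagates it.
  obtain ⟨a, ha⟩ : ∃ a : Letter,
      (if Even (c 0) then a else swap a) = twist t (y (c 0)) := by
    by_cases h : Even (c 0)
    · exact ⟨_, by rw [if_pos h]⟩
    · exact ⟨swap (twist t (y (c 0))), by rw [if_neg h, swap_swap]⟩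
  have hx : IsBlockStarts (fun i => if Even (f i) then a else swap a) b :=
    ⟨hmono, hb0.le, by have := hmono (show (0 : ℤ) < 1 by omega); omega,
      fun k i h1 h2 => by simp only [hfb k i h1 h2, hfb'], fun k => by
        simp only [hfb', Int.even_add_one]
        by_cases h : Even k <;> simp [h, swap_ne, (swap_ne _).symm]⟩
  refine ⟨_, b, hx, hb0, fun k => by rw [hb]; ring, letter_alternates hx hc hl t ?_⟩
  simp only [hfb', ha]

/-! ### Compactness -/

/-- The first `N` levels of a tower with type sequence `τ`. -/
structure IsPartialTower (N : ℕ) (τ : ℕ → Fin 2) (x : ℕ → BiSeq) (b : ℕ → ℤ → ℤ) : Prop where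
  blocks : ∀ n ≤ N, IsBlockStarts (x n) (b n)
  len : ∀ n < N, ∀ k, b n (k + 1) - b n k = ((x (n + 1) k : ℕ) : ℤ)
  letter : ∀ n < N, ∀ j, x n (b n (b (n + 1) j)) = twist (τ n) (x (n + 1) (b (n + 1) j))
  bound : ∀ n k, |b n k| ≤ 3 * |k| + 3

/-- Integrates downwards from the alternating sequence at the top, where every block has length 1.
The extra clause on level 0 is what allows one more primitive, since `len` says nothing about the
top level. -/
theorem exists_isPartialTower (N : ℕ) (τ : ℕ → Fin 2) : ∃ x b, IsPartialTower N τ x b ∧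
    ∀ k, b 0 (k + 1) - b 0 k = 1 ∨ b 0 (k + 1) - b 0 k = 3 := by
  induction N generalizing τ with
  | zero =>
    refine ⟨fun _ i => if Even i then one else three, fun _ => id, ⟨fun n _ => ⟨strictMono_id,
      le_rfl, by simp, fun k i h1 h2 => ?_, fun k => ?_⟩, by simp, by simp, fun n k => ?_⟩, by simp⟩
    · simp only [id] at h1 h2 ⊢
      rw [show i = k by omega]
    · simp only [id, Int.even_add_one]
      by_cases h : Even k <;> simp [h]
    · simp only [id]; have := abs_nonneg k; omega
  | succ N ih =>
    obtain ⟨x, b, h, hl⟩ := ih fun n => τ (n + 1)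
    obtain ⟨x', b', hb, h0, hl', hlet⟩ := exists_primitive (h.blocks 0 (Nat.zero_le _)) hl (τ 0)
    have hl'' : ∀ k, b' (k + 1) - b' k = 1 ∨ b' (k + 1) - b' k = 3 := fun k => by
      rw [hl']; exact_mod_cast val_eq _
    refine ⟨fun n => Nat.casesOn n x' x, fun n => Nat.casesOn n b' b, ⟨?_, ?_, ?_, ?_⟩, hl''⟩
    · rintro (_ | n) hn
      · exact hb
      · exact h.blocks n (by omega)
    · rintro (_ | n) hn
      · exact hl'
      · exact h.len n (by omega)
    · rintro (_ | n) hn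
      · exact hlet
      · exact h.letter n (by omega)
    · rintro (_ | n)
      · exact abs_le_of_increments (by simp [h0]) hl''
      · exact h.bound n

/-- Indices and letters are discrete, so even evaluation at a varying index is continuous, and each
clause is a closed condition on finitely many coordinates. -/
theorem isClosed_setOf_isBlockStarts :
    IsClosed {p : BiSeq × (ℤ → ℤ) | IsBlockStarts p.1 p.2} := by
  have hb : ∀ k, Continuous fun p : BiSeq × (ℤ → ℤ) => p.2 k := fun k => by fun_prop
  have hx : ∀ k, Continuous fun p : BiSeq × (ℤ → ℤ) => p.1 k := fun k => by fun_prop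
  have hxb : ∀ k, Continuous fun p : BiSeq × (ℤ → ℤ) => p.1 (p.2 k) := fun k =>
    (continuous_prod_of_discrete_right (f := fun q : BiSeq × ℤ => q.1 q.2).2
      fun i => continuous_apply i).comp (continuous_fst.prodMk (hb k))
  have : {p : BiSeq × (ℤ → ℤ) | IsBlockStarts p.1 p.2} =
      (⋂ k, {p | p.2 k < p.2 (k + 1)}) ∩ {p | p.2 0 ≤ 0 ∧ 0 < p.2 1} ∩
      (⋂ k, ⋂ i, {p | p.2 k ≤ i → i < p.2 (k + 1) → p.1 i = p.1 (p.2 k)}) ∩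
      ⋂ k, {p | p.1 (p.2 (k + 1)) ≠ p.1 (p.2 k)} := by
    ext p
    simp only [Set.mem_inter_iff, Set.mem_iInter, Set.mem_ofPred_eq]
    exact ⟨fun h => ⟨⟨⟨fun k => h.strictMono (by omega), h.zero_le, h.zero_lt⟩, h.const⟩, h.change⟩,
      fun h => ⟨strictMono_int_of_lt_succ h.1.1.1, h.1.1.2.1, h.1.1.2.2, h.1.2, h.2⟩⟩
  rw [this]
  refine ((IsClosed.inter ?_ ?_).inter ?_).inter ?_
  · exact isClosed_iInter fun k => (isClosed_discrete {q : ℤ × ℤ | q.1 < q.2}).preimage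
      ((hb k).prodMk (hb (k + 1)))
  · exact (isClosed_discrete {q : ℤ × ℤ | q.1 ≤ 0 ∧ 0 < q.2}).preimage ((hb 0).prodMk (hb 1))
  · exact isClosed_iInter fun k => isClosed_iInter fun i =>
      (isClosed_discrete {q : (ℤ × ℤ) × (Letter × Letter) |
        q.1.1 ≤ i → i < q.1.2 → q.2.1 = q.2.2}).preimage
        (((hb k).prodMk (hb (k + 1))).prodMk ((hx i).prodMk (hxb k)))
  · exact isClosed_iInter fun k => (isClosed_discrete {q : Letter × Letter | q.1 ≠ q.2}).preimage
      ((hxb (k + 1)).prodMk (hxb k))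

theorem isClosed_setOf_isPartialTower (N : ℕ) (τ : ℕ → Fin 2) :
    IsClosed {p : (ℕ → BiSeq) × (ℕ → ℤ → ℤ) | IsPartialTower N τ p.1 p.2} := by
  have hb : ∀ n k, Continuous fun p : (ℕ → BiSeq) × (ℕ → ℤ → ℤ) => p.2 n k := fun n k => by fun_prop
  have hx : ∀ n k, Continuous fun p : (ℕ → BiSeq) × (ℕ → ℤ → ℤ) => p.1 n k := fun n k => by fun_prop
  have eval : ∀ (n : ℕ) (f : (ℕ → BiSeq) × (ℕ → ℤ → ℤ) → ℤ), Continuous f →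
      Continuous fun p : (ℕ → BiSeq) × (ℕ → ℤ → ℤ) => p.1 n (f p) := fun n f hf =>
    (continuous_prod_of_discrete_right (f := fun q : BiSeq × ℤ => q.1 q.2).2
      fun i => continuous_apply i).comp (((continuous_apply n).comp continuous_fst).prodMk hf)
  have evalb : ∀ (n : ℕ) (f : (ℕ → BiSeq) × (ℕ → ℤ → ℤ) → ℤ), Continuous f →
      Continuous fun p : (ℕ → BiSeq) × (ℕ → ℤ → ℤ) => p.2 n (f p) := fun n f hf =>
    (continuous_prod_of_discrete_right (f := fun q : (ℤ → ℤ) × ℤ => q.1 q.2).2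
      fun i => continuous_apply i).comp (((continuous_apply n).comp continuous_snd).prodMk hf)
  have : {p : (ℕ → BiSeq) × (ℕ → ℤ → ℤ) | IsPartialTower N τ p.1 p.2} =
      (⋂ n, ⋂ (_ : n ≤ N), {p | IsBlockStarts (p.1 n) (p.2 n)}) ∩
      (⋂ n, ⋂ (_ : n < N), ⋂ k, {p | p.2 n (k + 1) - p.2 n k = ((p.1 (n + 1) k : ℕ) : ℤ)}) ∩
      (⋂ n, ⋂ (_ : n < N), ⋂ j,
        {p | p.1 n (p.2 n (p.2 (n + 1) j)) = twist (τ n) (p.1 (n + 1) (p.2 (n + 1) j))}) ∩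
      ⋂ n, ⋂ k, {p | |p.2 n k| ≤ 3 * |k| + 3} := by
    ext p
    simp only [Set.mem_inter_iff, Set.mem_iInter, Set.mem_ofPred_eq]
    exact ⟨fun h => ⟨⟨⟨h.blocks, h.len⟩, h.letter⟩, h.bound⟩,
      fun h => ⟨h.1.1.1, h.1.1.2, h.1.2, h.2⟩⟩
  rw [this]
  refine ((IsClosed.inter ?_ ?_).inter ?_).inter ?_
  · refine isClosed_iInter fun n => isClosed_iInter fun _ => ?_
    have : Continuous fun p : (ℕ → BiSeq) × (ℕ → ℤ → ℤ) => (p.1 n, p.2 n) := by fun_prop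
    exact isClosed_setOf_isBlockStarts.preimage this
  · exact isClosed_iInter fun n => isClosed_iInter fun _ => isClosed_iInter fun k =>
      (isClosed_discrete {q : (ℤ × ℤ) × Letter | q.1.1 - q.1.2 = ((q.2 : ℕ) : ℤ)}).preimage
        (((hb n (k + 1)).prodMk (hb n k)).prodMk (hx (n + 1) k))
  · exact isClosed_iInter fun n => isClosed_iInter fun _ => isClosed_iInter fun j =>
      (isClosed_discrete {q : Letter × Letter | q.1 = twist (τ n) q.2}).preimage
        ((eval n _ (evalb n _ (hb (n + 1) j))).prodMk (eval (n + 1) _ (hb (n + 1) j)))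
  · exact isClosed_iInter fun n => isClosed_iInter fun k =>
      (isClosed_discrete {z : ℤ | |z| ≤ 3 * |k| + 3}).preimage (hb n k)

/-- The field `bound`, imposed at all levels, confines the block starts to a product of finite
intervals. It costs nothing, as every tower satisfies it. -/
theorem isCompact_setOf_isPartialTower (N : ℕ) (τ : ℕ → Fin 2) :
    IsCompact {p : (ℕ → BiSeq) × (ℕ → ℤ → ℤ) | IsPartialTower N τ p.1 p.2} := by
  have hK : IsCompact ((Set.univ : Set (ℕ → BiSeq)) ×ˢ
      (Set.univ.pi fun _ : ℕ => Set.univ.pi fun k : ℤ =>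
        Set.Icc (-(3 * |k| + 3)) (3 * |k| + 3))) :=
    isCompact_univ.prod (isCompact_univ_pi fun _ => isCompact_univ_pi fun k => isCompact_Icc)
  refine hK.of_isClosed_subset (isClosed_setOf_isPartialTower N τ) fun p hp => ?_
  exact ⟨trivial, fun n _ k _ => abs_le.1 (hp.bound n k)⟩

theorem IsTower.isPartialTower {τ : ℕ → Fin 2} {x : ℕ → BiSeq} {b : ℕ → ℤ → ℤ}
    (h : IsTower τ x b) (N : ℕ) : IsPartialTower N τ x b where
  blocks n _ := h.blocks n
  len n _ := h.len n
  letter n _ := h.letter n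
  bound n := by
    have hl : ∀ k, b n (k + 1) - b n k = 1 ∨ b n (k + 1) - b n k = 3 := fun k => by
      rw [h.len]; exact_mod_cast val_eq _
    refine abs_le_of_increments ?_ hl
    have h1 := (h.blocks n).zero_le
    have h2 := (h.blocks n).zero_lt
    have h3 := hl 0
    rw [zero_add] at h3
    rw [abs_le]
    omega

theorem isTower_iff {τ : ℕ → Fin 2} {x : ℕ → BiSeq} {b : ℕ → ℤ → ℤ} :
    IsTower τ x b ↔ ∀ N, IsPartialTower N τ x b :=
  ⟨fun h N => h.isPartialTower N, fun h => ⟨fun n => (h n).blocks n le_rfl,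
    fun n => (h (n + 1)).len n (by omega), fun n => (h (n + 1)).letter n (by omega)⟩⟩

theorem Xtype_eq_image (τ : ℕ → Fin 2) : Xtype τ = (fun p : (ℕ → BiSeq) × (ℕ → ℤ → ℤ) => p.1 0) ''
    ⋂ N, {p | IsPartialTower N τ p.1 p.2} := by
  ext x
  simp only [mem_Xtype_iff, isTower_iff, Set.mem_image, Set.mem_iInter, Set.mem_ofPred_eq,
    Prod.exists]

theorem isCompact_Xtype (τ : ℕ → Fin 2) : IsCompact (Xtype τ) := by
  rw [Xtype_eq_image]
  refine IsCompact.image ?_ (by fun_prop)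
  exact (isCompact_setOf_isPartialTower 0 τ).of_isClosed_subset
    (isClosed_iInter fun N => isClosed_setOf_isPartialTower N τ) (Set.iInter_subset _ 0)

theorem nonempty_Xtype (τ : ℕ → Fin 2) : (Xtype τ).Nonempty := by
  rw [Xtype_eq_image, Set.image_nonempty]
  refine IsCompact.nonempty_iInter_of_sequence_nonempty_isCompact_isClosed _ (fun N p hp => ?_)
    (fun N => ?_) (isCompact_setOf_isPartialTower 0 τ) fun N => isClosed_setOf_isPartialTower N τ
  · exact ⟨fun n hn => hp.blocks n (by omega), fun n hn => hp.len n (by omega),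
      fun n hn => hp.letter n (by omega), hp.bound⟩
  · obtain ⟨x, b, h, -⟩ := exists_isPartialTower N τ
    exact ⟨(x, b), h⟩

theorem isSubshift_Xtype (τ : ℕ → Fin 2) : IsSubshift (Xtype τ) :=
  ⟨nonempty_Xtype τ, (isCompact_Xtype τ).isClosed, shift_image_Xtype τ⟩

/-! ### Counting occurrences of a word -/

/-- The word `w` occurs in `x` at the index `i`. -/
def OccursAt (x : BiSeq) (w : List Letter) (i : ℤ) : Prop :=
  ∀ (k : ℕ) (h : k < w.length), x (i + k) = w[k]

open scoped Classical in
theorem exists_hits (x : BiSeq) (w : List Letter) : ∃ H : ℤ → ℤ,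
    H 0 = 0 ∧ ∀ k, H (k + 1) = H k + if OccursAt x w k then 1 else 0 :=
  exists_int_sum _

/-- The function with `hits x w 0 = 0` which increases by `1` exactly at the indices where `w`
occurs in `x`. -/
noncomputable def hits (x : BiSeq) (w : List Letter) : ℤ → ℤ := (exists_hits x w).choose

theorem hits_zero (x : BiSeq) (w : List Letter) : hits x w 0 = 0 := (exists_hits x w).choose_spec.1

open scoped Classical in
theorem hits_succ (x : BiSeq) (w : List Letter) (k : ℤ) :
    hits x w (k + 1) = hits x w k + if OccursAt x w k then 1 else 0 :=
  (exists_hits x w).choose_spec.2 k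

theorem hits_sub_mem (x : BiSeq) (w : List Letter) {s t : ℤ} (h : s ≤ t) :
    0 ≤ hits x w t - hits x w s ∧ hits x w t - hits x w s ≤ t - s := by
  obtain ⟨n, rfl⟩ : ∃ n : ℕ, t = s + n := ⟨(t - s).toNat, by omega⟩
  clear h
  induction n with
  | zero => simp
  | succ n ih =>
    have := hits_succ x w (s + n)
    push_cast
    rw [← add_assoc, this]
    split_ifs <;> omega

theorem abs_hits_sub_le (x : BiSeq) (w : List Letter) (s t : ℤ) :
    |hits x w t - hits x w s| ≤ |t - s| := by
  rcases le_total s t with h | h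
  · have := hits_sub_mem x w h
    rw [abs_of_nonneg this.1, abs_of_nonneg (by omega)]
    exact this.2
  · have := hits_sub_mem x w h
    rw [abs_of_nonpos (by omega), abs_of_nonpos (by omega)]
    omega

/-- Only occurrences starting in the last `w.length` positions can look beyond the common segment.
-/
theorem hits_congr {x x' : BiSeq} (w : List Letter) {s s' : ℤ} {g : ℕ}
    (h : ∀ i : ℕ, i < g → x (s + i) = x' (s' + i)) :
    |(hits x w (s + g) - hits x w s) - (hits x' w (s' + g) - hits x' w s')| ≤ w.length := by
  have key : ∀ i : ℕ, i + w.length ≤ g →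
      hits x w (s + i) - hits x w s = hits x' w (s' + i) - hits x' w s' := fun i => by
    induction i with
    | zero => simp
    | succ i ih =>
      intro hi
      have h1 := ih (by omega)
      have h2 : OccursAt x w (s + i) ↔ OccursAt x' w (s' + i) := by
        refine forall₂_congr fun k hk => ?_
        have := h (i + k) (by omega)
        push_cast at this
        rw [add_assoc, this, add_assoc]
      have h3 := hits_succ x w (s + i)
      have h4 := hits_succ x' w (s' + i)
      push_cast
      rw [← add_assoc, ← add_assoc, h3, h4]
      by_cases h5 : OccursAt x' w (s' + i)
      · rw [if_pos h5, if_pos (h2.2 h5)]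
        omega
      · rw [if_neg h5, if_neg (mt h2.1 h5)]
        omega
  rcases le_or_gt w.length g with hg | hg
  · have h1 := key (g - w.length) (by omega)
    have h2 := hits_sub_mem x w (show s + (g - w.length : ℕ) ≤ s + g by omega)
    have h3 := hits_sub_mem x' w (show s' + (g - w.length : ℕ) ≤ s' + g by omega)
    rw [abs_le]
    omega
  · have h2 := hits_sub_mem x w (show s ≤ s + g by omega)
    have h3 := hits_sub_mem x' w (show s' ≤ s' + g by omega)
    rw [abs_le]
    omega

open scoped Classical in
theorem hits_natCast (x : BiSeq) (w : List Letter) (n : ℕ) :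
    hits x w n = ((Finset.range n).filter fun i : ℕ => OccursAt x w i).card := by
  induction n with
  | zero => simp [hits_zero]
  | succ n ih =>
    push_cast
    rw [hits_succ, ih, Finset.range_add_one, Finset.filter_insert]
    split_ifs
    · rw [Finset.card_insert_of_notMem (by simp)]; push_cast; ring
    · simp

/-- The subtraction is truncated: no occurrence fits when `w` has more than `n` letters. -/
theorem occurrences_eq_hits (x : BiSeq) (w : List Letter) (n : ℕ) :
    (occurrences x w n : ℤ) = hits x w (n + 1 - w.length : ℕ) := by
  classical
  rw [hits_natCast, occurrences]
  congr 2
  ext i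
  simp only [Finset.mem_filter, Finset.mem_range]
  constructor
  · rintro ⟨-, h1, h2⟩
    exact ⟨by omega, h2⟩
  · rintro ⟨h1, h2⟩
    exact ⟨by omega, by omega, h2⟩

theorem abs_occurrences_sub_hits_le (x : BiSeq) (w : List Letter) (n : ℕ) :
    |(occurrences x w n : ℤ) - hits x w n| ≤ w.length + 1 := by
  rw [occurrences_eq_hits]
  refine (abs_hits_sub_le x w _ _).trans ?_
  rw [abs_le]
  omega

/-! ### Pairs of consecutive blocks -/

/-- The length of the word represented by two consecutive blocks at level `n`, where `e` is the
letter of the first block and `m`, `m'` are the lengths of the blocks. -/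
def pairLen (τ : ℕ → Fin 2) : ℕ → Letter → Letter → Letter → ℕ
  | 0, _, m, m' => m + m'
  | n + 1, e, m, m' =>
    (if m = one then 0 else pairLen τ n (twist (τ n) e) e e) +
      pairLen τ n (twist (τ n) e) e (swap e) +
      (if m' = one then 0 else pairLen τ n (twist (τ n) e) (swap e) (swap e))

/-- These inequalities are stable under the recursion, which is why they are proved together. The
comparisons give the ratio 6 of `pairLen_succ_le`; the linear growth makes boundary effects
negligible. -/
theorem pairLen_ineq (τ : ℕ → Fin 2) (n : ℕ) (e : Letter) :
    pairLen τ n e one one ≤ pairLen τ n e one three ∧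
    pairLen τ n e one one ≤ pairLen τ n e three one ∧
    pairLen τ n e one three ≤ pairLen τ n e three three ∧
    pairLen τ n e three one ≤ pairLen τ n e three three ∧
    pairLen τ n e three three ≤ 2 * (pairLen τ n e one one + pairLen τ n e one three) ∧
    pairLen τ n e three three ≤ 2 * (pairLen τ n e one one + pairLen τ n e three one) ∧
    n + 2 ≤ 2 * pairLen τ n e one one ∧
    n + 3 ≤ 2 * pairLen τ n e one three ∧
    n + 3 ≤ 2 * pairLen τ n e three one := by
  induction n generalizing e with
  | zero => simp [pairLen, val_one, val_three]
  | succ n ih =>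
    have := ih (twist (τ n) e)
    rcases eq_one_or_three e with rfl | rfl <;> simp [pairLen] <;> omega

theorem le_two_mul_pairLen (τ : ℕ → Fin 2) (n : ℕ) (e m m' : Letter) :
    n + 2 ≤ 2 * pairLen τ n e m m' := by
  have := pairLen_ineq τ n e
  rcases eq_one_or_three m with rfl | rfl <;> rcases eq_one_or_three m' with rfl | rfl <;> omega

theorem pairLen_le (τ : ℕ → Fin 2) (n : ℕ) (e m m' : Letter) :
    pairLen τ n e m m' ≤ pairLen τ n e three three := by
  have := pairLen_ineq τ n e
  rcases eq_one_or_three m with rfl | rfl <;> rcases eq_one_or_three m' with rfl | rfl <;> omega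

theorem pairLen_succ_le (τ : ℕ → Fin 2) (n : ℕ) (e m m' : Letter) :
    pairLen τ (n + 1) e m m' ≤ 6 * pairLen τ n (twist (τ n) e) e (swap e) := by
  refine (pairLen_le τ (n + 1) e m m').trans ?_
  have := pairLen_ineq τ n (twist (τ n) e)
  rcases eq_one_or_three e with rfl | rfl <;> simp [pairLen] <;> omega

/-- The index in the bottom sequence of the first position represented by the index `k` of
level `n`. -/
def cut (b : ℕ → ℤ → ℤ) : ℕ → ℤ → ℤ
  | 0, k => k
  | n + 1, k => cut b n (b n k)

namespace IsTower

variable {τ : ℕ → Fin 2} {x x' : ℕ → BiSeq} {b b' : ℕ → ℤ → ℤ}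

/-- Two consecutive blocks of level `n + 1` are made of one, two or three pairs of consecutive
blocks of level `n`. -/
theorem pair_decomposition (h : IsTower τ x b) (n : ℕ) (j : ℤ) {e : Letter}
    (he : x (n + 1) (b (n + 1) j) = e) : ∃ k : ℤ,
    (x n (b n k) = twist (τ n) e ∧ x (n + 1) k = e ∧ x (n + 1) (k + 1) = swap e) ∧
    (x (n + 2) j = one ∧ b (n + 1) j = k ∨ x (n + 2) j ≠ one ∧ b (n + 1) j + 2 = k ∧
      x n (b n (b (n + 1) j)) = twist (τ n) e ∧ x (n + 1) (b (n + 1) j) = e ∧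
      x (n + 1) (b (n + 1) j + 1) = e) ∧
    (x (n + 2) (j + 1) = one ∧ b (n + 1) (j + 2) = k + 2 ∨
      x (n + 2) (j + 1) ≠ one ∧ b (n + 1) (j + 2) = k + 2 + 2 ∧
      x n (b n (k + 2)) = twist (τ n) e ∧ x (n + 1) (k + 2) = swap e ∧
      x (n + 1) (k + 2 + 1) = swap e) := by
  have hB := h.blocks (n + 1)
  have hl := h.len (n + 1) j
  have hl' := h.len (n + 1) (j + 1)
  rw [show j + 1 + 1 = j + 2 by ring] at hl'
  have hs := hB.succ_eq_swap j
  rw [he] at hs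
  have ht : x n (b n (b (n + 1) j)) = twist (τ n) e := by rw [h.letter, he]
  have hc : ∀ i, b (n + 1) j ≤ i → i < b (n + 1) (j + 1) → x (n + 1) i = e := fun i h1 h2 =>
    (hB.const j i h1 h2).trans he
  have hc' : ∀ i, b (n + 1) (j + 1) ≤ i → i < b (n + 1) (j + 2) → x (n + 1) i = swap e :=
    fun i h1 h2 => (hB.const (j + 1) i h1 (by
      rwa [show j + 1 + 1 = j + 2 by ring])).trans hs
  have ht' : x n (b n (b (n + 1) (j + 1) - 1)) = twist (τ n) e := by
    have := (h.blocks n).succ_eq_swap (b (n + 1) (j + 1) - 1)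
    rw [sub_add_cancel, h.letter, hs, twist_swap] at this
    simpa using (congrArg swap this).symm
  have h1 : (0 : ℤ) < ((x (n + 1 + 1) j : ℕ) : ℤ) := by
    rcases val_eq (x (n + 1 + 1) j) with h | h <;> omega
  have h2 : (0 : ℤ) < ((x (n + 1 + 1) (j + 1) : ℕ) : ℤ) := by
    rcases val_eq (x (n + 1 + 1) (j + 1)) with h | h <;> omega
  -- The middle pair straddles the change of run: it begins at the last index of the first run.
  refine ⟨b (n + 1) (j + 1) - 1, ⟨ht', hc _ (by omega) (by omega),
    hc' _ (by omega) (by omega)⟩, ?_, ?_⟩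
  · rcases eq_one_or_three (x (n + 2) j) with h3 | h3
    · rw [h3, val_one] at hl
      exact Or.inl ⟨h3, by push_cast at hl; omega⟩
    · rw [h3, val_three] at hl
      push_cast at hl
      exact Or.inr ⟨by simp [h3], by omega, ht, he, hc _ (by omega) (by omega)⟩
  · rcases eq_one_or_three (x (n + 2) (j + 1)) with h3 | h3
    · rw [h3, val_one] at hl'
      exact Or.inl ⟨h3, by push_cast at hl'; omega⟩
    · rw [h3, val_three] at hl'
      push_cast at hl'
      exact Or.inr ⟨by simp [h3], by omega, by rw [(h.blocks n).add_two, ht'],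
        hc' _ (by omega) (by omega), hc' _ (by omega) (by omega)⟩

/-- Note the offset: `cut b (n + 1) j` is where the `j`-th block of level `n` begins at the bottom.
Lengths add up along `pair_decomposition`. -/
theorem cut_add_two (h : IsTower τ x b) (n : ℕ) (j : ℤ) {e m m' : Letter}
    (he : x n (b n j) = e) (hm : x (n + 1) j = m) (hm' : x (n + 1) (j + 1) = m') :
    cut b (n + 1) (j + 2) = cut b (n + 1) j + pairLen τ n e m m' := by
  induction n generalizing j e m m' with
  | zero =>
    have h1 := h.len 0 j
    have h2 := h.len 0 (j + 1)
    rw [hm] at h1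
    rw [hm', show j + 1 + 1 = j + 2 by ring] at h2
    simp only [cut, pairLen]
    push_cast
    omega
  | succ n ih =>
    obtain ⟨k, ⟨h1, h2, h3⟩, h4, h5⟩ := h.pair_decomposition n j he
    rw [hm] at h4
    rw [hm'] at h5
    have hk := ih k h1 h2 h3
    have hA : cut b (n + 1) k = cut b (n + 1) (b (n + 1) j) +
        ((if m = one then 0 else pairLen τ n (twist (τ n) e) e e : ℕ) : ℤ) := by
      rcases h4 with ⟨h4, h6⟩ | ⟨h4, h6, h7, h8, h9⟩
      · simp [h4, h6]
      · rw [if_neg h4, ← h6]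
        exact ih _ h7 h8 h9
    have hB : cut b (n + 1) (b (n + 1) (j + 2)) = cut b (n + 1) (k + 2) +
        ((if m' = one then 0 else pairLen τ n (twist (τ n) e) (swap e) (swap e) : ℕ) : ℤ) := by
      rcases h5 with ⟨h5, h6⟩ | ⟨h5, h6, h7, h8, h9⟩
      · simp [h5, h6]
      · rw [if_neg h5, h6]
        exact ih _ h7 h8 h9
    change cut b (n + 1) (b (n + 1) (j + 2)) = cut b (n + 1) (b (n + 1) j) + _
    rw [hB, hk, hA, pairLen]
    push_cast
    ring

end IsTower

theorem agree_append {x x' : BiSeq} {s s' : ℤ} {g l : ℕ}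
    (h : ∀ i : ℕ, i < g → x (s + i) = x' (s' + i))
    (h' : ∀ i : ℕ, i < l → x (s + g + i) = x' (s' + g + i)) (i : ℕ) (hi : i < g + l) :
    x (s + i) = x' (s' + i) := by
  rcases lt_or_ge i g with h1 | h1
  · exact h i h1
  · have := h' (i - g) (by omega)
    rwa [Nat.cast_sub h1, add_add_sub_cancel, add_add_sub_cancel] at this

namespace IsTower

variable {τ : ℕ → Fin 2} {x x' : ℕ → BiSeq} {b b' : ℕ → ℤ → ℤ}

/-- The word represented by two consecutive blocks at level `n` only depends on the letter of the
first one and on the lengths of both. -/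
theorem agree_pair (h : IsTower τ x b) (h' : IsTower τ x' b') (n : ℕ) (j j' : ℤ) {e m m' : Letter}
    (he : x n (b n j) = e) (hm : x (n + 1) j = m) (hm' : x (n + 1) (j + 1) = m')
    (ke : x' n (b' n j') = e) (km : x' (n + 1) j' = m) (km' : x' (n + 1) (j' + 1) = m')
    (i : ℕ) (hi : i < pairLen τ n e m m') :
    x 0 (cut b (n + 1) j + i) = x' 0 (cut b' (n + 1) j' + i) := by
  induction n generalizing j j' e m m' i with
  | zero =>
    have base : ∀ {x : ℕ → BiSeq} {b : ℕ → ℤ → ℤ} (_ : IsTower τ x b) {j : ℤ}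
        (_ : x 0 (b 0 j) = e) (_ : x 1 j = m) (_ : x 1 (j + 1) = m'),
        x 0 (b 0 j + i) = if i < (m : ℕ) then e else swap e := by
      intro x b h j he hm hm'
      have h1 := h.len 0 j
      have h2 := h.len 0 (j + 1)
      rw [zero_add, hm] at h1
      rw [zero_add, hm'] at h2
      have hs := (h.blocks 0).succ_eq_swap j
      simp only [pairLen] at hi
      split_ifs with hlt
      · exact ((h.blocks 0).const j _ (by omega) (by omega)).trans he
      · rw [(h.blocks 0).const (j + 1) _ (by omega) (by omega), hs, he]
    exact (base h he hm hm').trans (base h' ke km km').symm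
  | succ n ih =>
    obtain ⟨k, ⟨h1, h2, h3⟩, h4, h5⟩ := h.pair_decomposition n j he
    obtain ⟨k', ⟨h1', h2', h3'⟩, h4', h5'⟩ := h'.pair_decomposition n j' ke
    rw [hm] at h4
    rw [hm'] at h5
    rw [km] at h4'
    rw [km'] at h5'
    have hk := h.cut_add_two n k h1 h2 h3
    have hk' := h'.cut_add_two n k' h1' h2' h3'
    rw [pairLen] at hi
    have hA : ∃ g : ℕ, g = (if m = one then 0 else pairLen τ n (twist (τ n) e) e e) ∧
        cut b (n + 1) k = cut b (n + 1) (b (n + 1) j) + g ∧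
        cut b' (n + 1) k' = cut b' (n + 1) (b' (n + 1) j') + g ∧ ∀ i : ℕ, i < g →
        x 0 (cut b (n + 1) (b (n + 1) j) + i) = x' 0 (cut b' (n + 1) (b' (n + 1) j') + i) := by
      refine ⟨_, rfl, ?_⟩
      rcases h4 with ⟨h4, h6⟩ | ⟨h4, h6, h7, h8, h9⟩
      · rcases h4' with ⟨-, h6'⟩ | ⟨h4', -⟩
        · simp [h4, h6, h6']
        · exact absurd h4 h4'
      · rcases h4' with ⟨h4', -⟩ | ⟨-, h6', h7', h8', h9'⟩
        · exact absurd h4' h4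
        · rw [if_neg h4, ← h6, ← h6']
          exact ⟨h.cut_add_two n _ h7 h8 h9, h'.cut_add_two n _ h7' h8' h9',
            ih _ _ h7 h8 h9 h7' h8' h9'⟩
    obtain ⟨g, hg, hAk, hAk', hag⟩ := hA
    rw [← hg] at hi
    change x 0 (cut b (n + 1) (b (n + 1) j) + i) = x' 0 (cut b' (n + 1) (b' (n + 1) j') + i)
    refine agree_append (agree_append hag fun i hi => ?_) (fun i hi => ?_) i hi
    · rw [← hAk, ← hAk']
      exact ih _ _ h1 h2 h3 h1' h2' h3' _ hi
    · rw [Nat.cast_add, ← add_assoc, ← add_assoc, ← hAk, ← hAk', ← hk, ← hk']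
      rcases h5 with ⟨h5, h6⟩ | ⟨h5, h6, h7, h8, h9⟩
      · simp [h5] at hi
      · rcases h5' with ⟨h5', -⟩ | ⟨-, h6', h7', h8', h9'⟩
        · exact absurd h5' h5
        · rw [if_neg h5] at hi
          exact ih _ _ h7 h8 h9 h7' h8' h9' _ hi

end IsTower

/-! ### Frequencies -/

/-- The density of the occurrences of `w` in the words represented by two consecutive blocks of
level `n`, the first one with letter `e`, is between `lo` and `hi`. -/
def DensityBetween (τ : ℕ → Fin 2) (w : List Letter) (n : ℕ) (e : Letter) (lo hi : ℝ) : Prop :=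
  ∀ x b, IsTower τ x b → ∀ j, x n (b n j) = e →
    lo * ((cut b (n + 1) (j + 2) : ℝ) - cut b (n + 1) j) ≤
      (hits (x 0) w (cut b (n + 1) (j + 2)) : ℝ) - hits (x 0) w (cut b (n + 1) j) ∧
    (hits (x 0) w (cut b (n + 1) (j + 2)) : ℝ) - hits (x 0) w (cut b (n + 1) j) ≤
      hi * ((cut b (n + 1) (j + 2) : ℝ) - cut b (n + 1) j)

variable {τ : ℕ → Fin 2} {w : List Letter}

theorem IsTower.cut_add_two_bounds {x : ℕ → BiSeq} {b : ℕ → ℤ → ℤ} (h : IsTower τ x b) (n : ℕ)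
    (j : ℤ) : cut b (n + 1) j < cut b (n + 1) (j + 2) ∧
      cut b (n + 1) (j + 2) ≤ cut b (n + 1) j + pairLen τ n (x n (b n j)) three three ∧
      (n + 2 : ℤ) ≤ 2 * (cut b (n + 1) (j + 2) - cut b (n + 1) j) := by
  have h1 := h.cut_add_two n j rfl rfl rfl
  have h2 := le_two_mul_pairLen τ n (x n (b n j)) (x (n + 1) j) (x (n + 1) (j + 1))
  have h3 := pairLen_le τ n (x n (b n j)) (x (n + 1) j) (x (n + 1) (j + 1))
  omega

theorem densityBetween_zero (e : Letter) : DensityBetween τ w 0 e 0 1 := by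
  intro x b h j _
  have h1 := (h.cut_add_two_bounds 0 j).1
  have h2 := hits_sub_mem (x 0) w h1.le
  refine ⟨?_, ?_⟩
  · rw [zero_mul]; exact_mod_cast h2.1
  · rw [one_mul]; exact_mod_cast h2.2

theorem abs_hits_common_sub_le {x x' : ℕ → BiSeq} {b b' : ℕ → ℤ → ℤ} (h : IsTower τ x b)
    (h' : IsTower τ x' b') {n : ℕ} {j j' : ℤ} {e m m' : Letter} (he : x n (b n j) = e)
    (hm : x (n + 1) j = m) (hm' : x (n + 1) (j + 1) = m') (ke : x' n (b' n j') = e)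
    (km : x' (n + 1) j' = m) (km' : x' (n + 1) (j' + 1) = m') :
    |((hits (x 0) w (cut b (n + 1) (j + 2)) : ℝ) - hits (x 0) w (cut b (n + 1) j)) -
      ((hits (x' 0) w (cut b' (n + 1) (j' + 2)) : ℝ) - hits (x' 0) w (cut b' (n + 1) j'))| ≤
      w.length := by
  have := hits_congr w (h.agree_pair h' n j j' he hm hm' ke km km')
  rw [← h.cut_add_two n j he hm hm', ← h'.cut_add_two n j' ke km km'] at this
  exact_mod_cast this

/-- The middle pair codes the same word in every tower, hence has a fixed density ρ up to boundary
effects, and it fills at least 1/6 of the pair. The outer parts have density in the old interval, so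
both ends of that interval are pulled towards ρ by a sixth of their distance. -/
theorem DensityBetween.succ {n : ℕ} {e : Letter} {lo hi : ℝ}
    (hd : DensityBetween τ w n (twist (τ n) e) lo hi) : ∃ lo' hi',
    DensityBetween τ w (n + 1) e lo' hi' ∧
      hi' - lo' ≤ 5 / 6 * (hi - lo) + 4 * w.length / (n + 3) := by
  by_cases hex : ∃ x b, IsTower τ x b ∧ ∃ j, x (n + 1) (b (n + 1) j) = e
  swap
  · exact ⟨0, _, fun x b h j hj => absurd ⟨x, b, h, j, hj⟩ hex, (sub_zero _).le⟩
  obtain ⟨x₀, b₀, h₀, j₀, hj₀⟩ := hex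
  obtain ⟨k₀, ⟨u1, u2, u3⟩, -, -⟩ := h₀.pair_decomposition n j₀ hj₀
  have hρ := hd x₀ b₀ h₀ k₀ u1
  have hg₀ := h₀.cut_add_two n k₀ u1 u2 u3
  set g : ℕ := pairLen τ n (twist (τ n) e) e (swap e) with hg
  set B : ℝ := (hits (x₀ 0) w (cut b₀ (n + 1) (k₀ + 2)) : ℝ) -
    hits (x₀ 0) w (cut b₀ (n + 1) k₀) with hB
  have hgR : (cut b₀ (n + 1) (k₀ + 2) : ℝ) - cut b₀ (n + 1) k₀ = g := by
    rw [hg₀]; push_cast; ring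
  rw [hgR] at hρ
  have hgpos : (0 : ℝ) < g := by
    have : 0 < g := by
      have := le_two_mul_pairLen τ n (twist (τ n) e) e (swap e)
      omega
    exact_mod_cast this
  set ρ : ℝ := B / g with hρdef
  have hBρ : B = ρ * g := by rw [hρdef]; field_simp
  rw [hBρ] at hρ
  have hρ1 : lo ≤ ρ := le_of_mul_le_mul_right hρ.1 hgpos
  have hρ2 : ρ ≤ hi := le_of_mul_le_mul_right hρ.2 hgpos
  have hW : (0 : ℝ) ≤ w.length := Nat.cast_nonneg _
  have hn3 : (0 : ℝ) < n + 3 := by positivity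
  refine ⟨lo + (ρ - lo) / 6 - 2 * w.length / (n + 3), hi - (hi - ρ) / 6 + 2 * w.length / (n + 3),
    fun x b h j hj => ?_, le_of_eq (by ring)⟩
  obtain ⟨k, ⟨v1, v2, v3⟩, v4, v5⟩ := h.pair_decomposition n j hj
  have hC := abs_hits_common_sub_le (w := w) h h₀ v1 v2 v3 u1 u2 u3
  rw [← hB, hBρ, abs_le] at hC
  have hgk : (cut b (n + 1) (k + 2) : ℝ) - cut b (n + 1) k = g := by
    rw [h.cut_add_two n k v1 v2 v3]; push_cast; ring
  have hA : lo * ((cut b (n + 1) k : ℝ) - cut b (n + 1) (b (n + 1) j)) ≤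
        (hits (x 0) w (cut b (n + 1) k) : ℝ) - hits (x 0) w (cut b (n + 1) (b (n + 1) j)) ∧
      (hits (x 0) w (cut b (n + 1) k) : ℝ) - hits (x 0) w (cut b (n + 1) (b (n + 1) j)) ≤
        hi * ((cut b (n + 1) k : ℝ) - cut b (n + 1) (b (n + 1) j)) := by
    rcases v4 with ⟨-, h6⟩ | ⟨-, h6, h7, -⟩
    · simp [h6]
    · rw [← h6]; exact hd x b h _ h7
  have hE : lo * ((cut b (n + 1) (b (n + 1) (j + 2)) : ℝ) - cut b (n + 1) (k + 2)) ≤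
        (hits (x 0) w (cut b (n + 1) (b (n + 1) (j + 2))) : ℝ) -
          hits (x 0) w (cut b (n + 1) (k + 2)) ∧
      (hits (x 0) w (cut b (n + 1) (b (n + 1) (j + 2))) : ℝ) -
          hits (x 0) w (cut b (n + 1) (k + 2)) ≤
        hi * ((cut b (n + 1) (b (n + 1) (j + 2)) : ℝ) - cut b (n + 1) (k + 2)) := by
    rcases v5 with ⟨-, h6⟩ | ⟨-, h6, h7, -⟩
    · simp [h6]
    · rw [h6]; exact hd x b h _ h7
  have hT := h.cut_add_two (n + 1) j rfl rfl rfl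
  have hT6 := pairLen_succ_le τ n e (x (n + 1 + 1) j) (x (n + 1 + 1) (j + 1))
  have hT2 := le_two_mul_pairLen τ (n + 1) e (x (n + 1 + 1) j) (x (n + 1 + 1) (j + 1))
  rw [hj] at hT
  rw [← hg] at hT6
  set T : ℕ := pairLen τ (n + 1) e (x (n + 1 + 1) j) (x (n + 1 + 1) (j + 1)) with hTdef
  have hTR : (cut b (n + 1 + 1) (j + 2) : ℝ) - cut b (n + 1 + 1) j = T := by
    rw [hT]; push_cast; ring
  have hT6R : (T : ℝ) ≤ 6 * g := by exact_mod_cast hT6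
  have hT2R : (n : ℝ) + 3 ≤ 2 * T := by
    have : n + 3 ≤ 2 * T := by omega
    exact_mod_cast this
  -- The boundary error `w.length`, spread over a word of length `T ≥ (n + 3) / 2`.
  have herr : (w.length : ℝ) ≤ 2 * w.length / (n + 3) * T := by
    rw [div_mul_eq_mul_div, le_div_iff₀ hn3]
    nlinarith
  have e1 : (ρ - lo) / 6 * T ≤ (ρ - lo) * g := by nlinarith
  have e2 : (hi - ρ) / 6 * T ≤ (hi - ρ) * g := by nlinarith
  rw [hTR]
  change _ ≤ (hits (x 0) w (cut b (n + 1) (b (n + 1) (j + 2))) : ℝ) -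
    hits (x 0) w (cut b (n + 1) (b (n + 1) j)) ∧
    (hits (x 0) w (cut b (n + 1) (b (n + 1) (j + 2))) : ℝ) -
    hits (x 0) w (cut b (n + 1) (b (n + 1) j)) ≤ _
  change (cut b (n + 1) (b (n + 1) (j + 2)) : ℝ) - cut b (n + 1) (b (n + 1) j) = T at hTR
  obtain ⟨A1, A2⟩ := hA
  obtain ⟨E1, E2⟩ := hE
  obtain ⟨C1, C2⟩ := hC
  have s1 : lo * ((cut b (n + 1) k : ℝ) - cut b (n + 1) (b (n + 1) j)) +
      lo * ((cut b (n + 1) (b (n + 1) (j + 2)) : ℝ) - cut b (n + 1) (k + 2)) = lo * (T - g) := by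
    rw [← hTR, ← hgk]; ring
  have s2 : hi * ((cut b (n + 1) k : ℝ) - cut b (n + 1) (b (n + 1) j)) +
      hi * ((cut b (n + 1) (b (n + 1) (j + 2)) : ℝ) - cut b (n + 1) (k + 2)) = hi * (T - g) := by
    rw [← hTR, ← hgk]; ring
  constructor <;> linarith

theorem exists_densityBetween (τ : ℕ → Fin 2) (w : List Letter) (n : ℕ) (e : Letter) :
    ∃ lo hi, DensityBetween τ w n e lo hi ∧ hi - lo ≤ (200 * w.length + 10) / (n + 10) := by
  induction n generalizing e with
  | zero =>
    refine ⟨0, 1, densityBetween_zero e, ?_⟩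
    have : (0 : ℝ) ≤ w.length := Nat.cast_nonneg _
    rw [le_div_iff₀ (by positivity)]
    push_cast
    linarith
  | succ n ih =>
    obtain ⟨lo, hi, h, hlh⟩ := ih (twist (τ n) e)
    obtain ⟨lo', hi', h', hlh'⟩ := h.succ
    refine ⟨lo', hi', h', hlh'.trans ?_⟩
    have hW : (0 : ℝ) ≤ w.length := Nat.cast_nonneg _
    have hn : (0 : ℝ) ≤ n := Nat.cast_nonneg _
    -- The shift by 10 makes `5/6 ≤ 11/12 * (n + 10) / (n + 11)` hold for all `n`, with equality at
    -- 0. The remaining twelfth absorbs the boundary error, which is what 200 is for.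
    have h1 : 5 / 6 * (hi - lo) ≤ 11 / 12 * ((200 * w.length + 10) / (n + 11)) := by
      refine (mul_le_mul_of_nonneg_left hlh (by norm_num)).trans ?_
      rw [mul_div_assoc', mul_div_assoc', div_le_div_iff₀ (by positivity) (by positivity)]
      nlinarith [mul_nonneg hW hn]
    have h2 : 4 * (w.length : ℝ) / (n + 3) ≤ 1 / 12 * ((200 * w.length + 10) / (n + 11)) := by
      rw [mul_div_assoc', div_le_div_iff₀ (by positivity) (by positivity)]
      nlinarith [mul_nonneg hW hn]
    have h3 : ((n + 1 : ℕ) : ℝ) + 10 = n + 11 := by push_cast; ring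
    rw [h3]
    linarith

theorem exists_le_lt_of_bounded_gaps {t : ℕ → ℤ} {M : ℤ} (h1 : ∀ i, t i < t (i + 1))
    (h2 : ∀ i, t (i + 1) ≤ t i + M) (N : ℕ) : ∃ i, t i ≤ t 0 + N ∧ t 0 + N < t i + M := by
  induction N with
  | zero => exact ⟨0, by simp, by have := h1 0; have := h2 0; push_cast; omega⟩
  | succ N ih =>
    obtain ⟨i, hi, hi'⟩ := ih
    have := h1 i
    have := h2 i
    have := h1 (i + 1)
    have := h2 (i + 1)
    push_cast
    by_cases h : t (i + 1) ≤ t 0 + (N + 1)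
    · exact ⟨i + 1, h, by omega⟩
    · exact ⟨i, by omega, by omega⟩

/-- Every second block of level `n` has letter `one`, so pairs starting with that letter tile the
sequence with bounded gaps. A prefix is a union of such pairs up to a bounded error. -/
theorem DensityBetween.occurrences_bounds {n : ℕ} {lo hi : ℝ} (hd : DensityBetween τ w n one lo hi)
    {x : BiSeq} (hx : x ∈ Xtype τ) : ∃ C : ℝ, ∀ N : ℕ,
    lo * N - C ≤ occurrences x w N ∧ (occurrences x w N : ℝ) ≤ hi * N + C := by
  obtain ⟨x, b, h, rfl⟩ := mem_Xtype_iff.1 hx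
  obtain ⟨j, hj⟩ : ∃ j, x n (b n j) = one := by
    rcases eq_one_or_three (x n (b n 0)) with h0 | h0
    · exact ⟨0, h0⟩
    · exact ⟨0 + 1, by rw [(h.blocks n).succ_eq_swap, h0, swap_three]⟩
  set t : ℕ → ℤ := fun i => cut b (n + 1) (j + 2 * i) with ht
  have hone : ∀ i : ℕ, x n (b n (j + 2 * i)) = one := fun i => by
    induction i with
    | zero => simpa using hj
    | succ i ih =>
      have := (h.blocks n).add_two (j + 2 * i)
      rwa [ih, show j + 2 * (i : ℤ) + 2 = j + 2 * ((i + 1 : ℕ) : ℤ) by push_cast; ring] at this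
  have htt : ∀ i, t (i + 1) = cut b (n + 1) (j + 2 * i + 2) := fun i => by
    simp only [ht]; push_cast; ring_nf
  have hbd := fun i : ℕ => h.cut_add_two_bounds n (j + 2 * i)
  set M : ℤ := ((pairLen τ n one three three : ℕ) : ℤ) with hM
  have hgap : ∀ i, t i < t (i + 1) := fun i => by rw [htt]; exact (hbd i).1
  have hgap' : ∀ i, t (i + 1) ≤ t i + M := fun i => by
    rw [htt]; have := (hbd i).2.1; rwa [hone] at this
  have hsum : ∀ i, lo * ((t i : ℝ) - t 0) ≤ (hits (x 0) w (t i) : ℝ) - hits (x 0) w (t 0) ∧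
      (hits (x 0) w (t i) : ℝ) - hits (x 0) w (t 0) ≤ hi * ((t i : ℝ) - t 0) := fun i => by
    induction i with
    | zero => simp
    | succ i ih =>
      have := hd x b h _ (hone i)
      rw [← htt] at this
      change lo * ((t (i + 1) : ℝ) - t i) ≤ (hits (x 0) w (t (i + 1)) : ℝ) - hits (x 0) w (t i) ∧
        (hits (x 0) w (t (i + 1)) : ℝ) - hits (x 0) w (t i) ≤ hi * ((t (i + 1) : ℝ) - t i) at this
      constructor <;> linarith [this.1, this.2, ih.1, ih.2]
  -- The terms come from replacing occurrences by `hits`, from starting the tiling at `t 0` instead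
  -- of 0, and from the incomplete last pair, of length at most `M`.
  refine ⟨w.length + 1 + 2 * |(t 0 : ℝ)| + M + (|lo| + |hi|) * M, fun N => ?_⟩
  obtain ⟨i, hi1, hi2⟩ := exists_le_lt_of_bounded_gaps hgap hgap' N
  have a1 := abs_occurrences_sub_hits_le (x 0) w N
  have a2 := abs_hits_sub_le (x 0) w (t i) N
  have a3 := abs_hits_sub_le (x 0) w 0 (t 0)
  rw [hits_zero, sub_zero, sub_zero] at a3
  have a4 : |(N : ℤ) - t i| ≤ |t 0| + M := by
    have := neg_abs_le (t 0)
    have := le_abs_self (t 0)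
    rw [abs_le]
    omega
  have a5 := a2.trans a4
  have hi1R : (t i : ℝ) ≤ t 0 + N := by exact_mod_cast hi1
  have hi2R : (t 0 : ℝ) + N < t i + M := by exact_mod_cast hi2
  rify at a1 a3 a5
  rw [abs_le] at a1 a3 a5
  have b1 : |lo * (N - ((t i : ℝ) - t 0))| ≤ |lo| * M := by
    rw [abs_mul]
    exact mul_le_mul_of_nonneg_left (abs_le.2 ⟨by linarith, by linarith⟩) (abs_nonneg _)
  have b2 : |hi * (N - ((t i : ℝ) - t 0))| ≤ |hi| * M := by
    rw [abs_mul]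
    exact mul_le_mul_of_nonneg_left (abs_le.2 ⟨by linarith, by linarith⟩) (abs_nonneg _)
  rw [abs_le] at b1 b2
  have hM0 : (0 : ℝ) ≤ M := by rw [hM]; positivity
  have c1 : 0 ≤ |lo| * (M : ℝ) := by positivity
  have c2 : 0 ≤ |hi| * (M : ℝ) := by positivity
  have := hsum i
  constructor <;> linarith [this.1, this.2, b1.1, b1.2, b2.1, b2.2,
    a1.1, a1.2, a3.1, a3.2, a5.1, a5.2]

theorem eventually_le_div {u : ℕ → ℝ} {a C : ℝ} (h : ∀ N : ℕ, a * N - C ≤ u N)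
    {ε : ℝ} (hε : 0 < ε) :
    ∀ᶠ N : ℕ in atTop, a - ε ≤ u N / N := by
  filter_upwards [eventually_gt_atTop 0, eventually_ge_atTop ⌈C / ε⌉₊] with N h0 hN
  have h0' : (0 : ℝ) < N := by exact_mod_cast h0
  rw [le_div_iff₀ h0']
  have := (Nat.le_ceil _).trans (Nat.cast_le (α := ℝ).2 hN)
  rw [div_le_iff₀ hε] at this
  nlinarith [h N]

theorem exists_hasFrequency (τ : ℕ → Fin 2) (w : List Letter) :
    ∃ f, ∀ x ∈ Xtype τ, HasFrequency x w f := by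
  choose lo hi hd hlh using fun n => exists_densityBetween τ w n one
  have hlow : ∀ x ∈ Xtype τ, ∀ n, ∀ ε > 0,
      ∀ᶠ N : ℕ in atTop, lo n - ε ≤ (occurrences x w N : ℝ) / N := fun x hx n ε hε => by
    obtain ⟨C, hC⟩ := (hd n).occurrences_bounds hx
    exact eventually_le_div (fun N => (hC N).1) hε
  have hupp : ∀ x ∈ Xtype τ, ∀ n, ∀ ε > 0,
      ∀ᶠ N : ℕ in atTop, (occurrences x w N : ℝ) / N ≤ hi n + ε := fun x hx n ε hε => by
    obtain ⟨C, hC⟩ := (hd n).occurrences_bounds hx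
    filter_upwards [eventually_le_div (u := fun N => -(occurrences x w N : ℝ)) (a := -hi n) (C := C)
      (fun N => by linarith [(hC N).2]) hε] with N hN
    rw [neg_div] at hN
    linarith
  obtain ⟨x₀, hx₀⟩ := nonempty_Xtype τ
  -- Both bounds apply to the same point of `Xtype τ`, whose existence is essential here.
  have hle : ∀ n m, lo n ≤ hi m := fun n m => by
    refine le_of_forall_pos_le_add fun ε hε => ?_
    obtain ⟨N, h1, h2⟩ := ((hlow x₀ hx₀ n (ε / 2) (by positivity)).and
      (hupp x₀ hx₀ m (ε / 2) (by positivity))).exists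
    linarith
  have hb : BddAbove (Set.range lo) := ⟨hi 0, by rintro _ ⟨n, rfl⟩; exact hle n 0⟩
  refine ⟨⨆ n, lo n, fun x hx => Metric.tendsto_atTop'.2 fun ε hε => ?_⟩
  obtain ⟨n, hn⟩ := exists_nat_gt ((200 * w.length + 10) / (ε / 2))
  rw [div_lt_iff₀ (by positivity)] at hn
  have hn' : hi n - lo n < ε / 2 := by
    refine (hlh n).trans_lt ?_
    rw [div_lt_iff₀ (by positivity)]
    nlinarith
  obtain ⟨N₀, hN₀⟩ := eventually_atTop.1 ((hlow x hx n (ε / 2) (by positivity)).and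
    (hupp x hx n (ε / 2) (by positivity)))
  refine ⟨N₀, fun N hN => ?_⟩
  have h1 := hN₀ N hN.le
  have h2 := le_ciSup hb n
  have h3 := ciSup_le fun m => hle m n
  rw [Real.dist_eq, abs_lt]
  constructor <;> linarith [h1.1, h1.2]

/-! ### Invariant measures -/

open scoped ENNReal in
/-- The Krylov–Bogoliubov theorem. -/
theorem exists_invariant_probabilityMeasure {Y : Type*} [TopologicalSpace Y] [CompactSpace Y]
    [T2Space Y] [HasOuterApproxClosed Y] [MeasurableSpace Y] [BorelSpace Y] [Nonempty Y]
    {S : Y → Y} (hS : Continuous S) :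
    ∃ μ : Measure Y, IsProbabilityMeasure μ ∧ MeasurePreserving S μ μ := by
  obtain ⟨y⟩ := ‹Nonempty Y›
  let m : ℕ → Measure Y := fun N =>
    ((N + 1 : ℕ) : ℝ≥0∞)⁻¹ • ∑ i ∈ Finset.range (N + 1), Measure.dirac (S^[i] y)
  have hm : ∀ N, IsProbabilityMeasure (m N) := fun N => ⟨by
    simp only [m, Measure.smul_apply, Measure.coe_finsetSum, Finset.sum_apply, measure_univ,
      Finset.sum_const, Finset.card_range, nsmul_eq_mul, mul_one, smul_eq_mul]
    exact ENNReal.inv_mul_cancel (by simp) (ENNReal.natCast_ne_top _)⟩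
  have hint : ∀ (N : ℕ) (f : BoundedContinuousFunction Y ℝ), ∫ z, f z ∂(m N) =
      ((N : ℝ) + 1)⁻¹ * ∑ i ∈ Finset.range (N + 1), f (S^[i] y) := fun N f => by
    simp only [m]
    rw [integral_smul_measure, integral_finsetSum_measure fun i _ => f.integrable _]
    simp only [integral_dirac, smul_eq_mul, ENNReal.toReal_inv, ENNReal.toReal_natCast]
    push_cast
    rfl
  let P : ℕ → ProbabilityMeasure Y := fun N => ⟨m N, hm N⟩
  -- A limit along an ultrafilter replaces the extraction of a convergent subsequence of empirical
  -- measures.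
  let U : Ultrafilter ℕ := hyperfilter ℕ
  have hU : (U : Filter ℕ) ≤ atTop := Nat.hyperfilter_le_atTop
  obtain ⟨μ, -, hμ⟩ := isCompact_univ.ultrafilter_le_nhds (U.map P) (by simp)
  have hlim : Tendsto P U (𝓝 μ) := hμ
  rw [ProbabilityMeasure.tendsto_iff_forall_integral_tendsto] at hlim
  refine ⟨μ, inferInstance, hS.measurable, ?_⟩
  have : IsProbabilityMeasure (Measure.map S (μ : Measure Y)) :=
    Measure.isProbabilityMeasure_map hS.measurable.aemeasurable
  refine ext_of_forall_integral_eq_of_IsFiniteMeasure fun f => ?_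
  rw [integral_map hS.measurable.aemeasurable f.continuous.aestronglyMeasurable]
  have h1 := hlim f
  have h2 := hlim (f.compContinuous ⟨S, hS⟩)
  -- The averages of `f ∘ S` and `f` differ by this telescoped term.
  have h3 : Tendsto (fun N : ℕ => ((N : ℝ) + 1)⁻¹ * (f (S^[N + 1] y) - f y)) atTop (𝓝 0) := by
    have h4 : Tendsto (fun N : ℕ => ((N : ℝ) + 1)⁻¹) atTop (𝓝 0) := by
      simpa using tendsto_one_div_add_atTop_nhds_zero_nat (𝕜 := ℝ)
    refine bdd_le_mul_tendsto_zero' (2 * ‖f‖) (Eventually.of_forall fun N => ?_) h4 |>.congr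
      fun N => mul_comm _ _
    have h5 := f.norm_coe_le_norm (S^[N + 1] y)
    have h6 := f.norm_coe_le_norm y
    rw [Real.norm_eq_abs] at h5 h6
    exact (abs_sub _ _).trans (by linarith)
  have h4 := h1.add (h3.mono_left hU)
  rw [add_zero] at h4
  refine tendsto_nhds_unique h2 (h4.congr fun N => ?_)
  change ∫ z, f z ∂(m N) + _ = ∫ z, (f.compContinuous ⟨S, hS⟩) z ∂(m N)
  rw [hint, hint, ← mul_add]
  congr 1
  have h5 := Finset.sum_range_succ' (fun i => f (S^[i] y)) (N + 1)
  rw [Finset.sum_range_succ] at h5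
  simp only [BoundedContinuousFunction.compContinuous_apply, ContinuousMap.coe_mk,
    ← Function.iterate_succ_apply', Function.iterate_zero, id] at h5 ⊢
  linarith

theorem continuous_shift : Continuous shift := by
  unfold shift; fun_prop

theorem shift_iterate_apply (i : ℕ) (x : BiSeq) (k : ℤ) : shift^[i] x k = x (k + i) := by
  induction i generalizing x with
  | zero => simp
  | succ i ih => rw [Function.iterate_succ_apply, ih, shift]; push_cast; ring_nf

theorem shift_iterate_mem_cylinder (i : ℕ) (x : BiSeq) (w : List Letter) :
    shift^[i] x ∈ cylinder w ↔ OccursAt x w i := by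
  refine forall₂_congr fun k hk => ?_
  rw [shift_iterate_apply, add_comm]

theorem isClosed_cylinder (w : List Letter) : IsClosed (cylinder w) := by
  have : cylinder w = ⋂ (i : ℕ), ⋂ (h : i < w.length), {x : BiSeq | x i = w[i]} := by
    ext x; simp [cylinder]
  rw [this]
  exact isClosed_iInter fun i => isClosed_iInter fun _ =>
    isClosed_eq (continuous_apply _) continuous_const

theorem measurableSet_cylinder (w : List Letter) : MeasurableSet (cylinder w) :=
  (isClosed_cylinder w).measurableSet

theorem hits_eq_sum_indicator (x : BiSeq) (w : List Letter) (n : ℕ) :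
    (hits x w n : ℝ) =
      ∑ i ∈ Finset.range n, (shift^[i] ⁻¹' cylinder w).indicator (fun _ => (1 : ℝ)) x := by
  classical
  rw [hits_natCast]
  push_cast
  rw [Finset.card_filter]
  push_cast
  refine Finset.sum_congr rfl fun i _ => ?_
  simp only [Set.indicator_apply, Set.mem_preimage, shift_iterate_mem_cylinder]

theorem HasFrequency.tendsto_hits {x : BiSeq} {w : List Letter} {f : ℝ} (h : HasFrequency x w f) :
    Tendsto (fun n : ℕ => (hits x w n : ℝ) / n) atTop (𝓝 f) := by
  have h1 : Tendsto (fun n : ℕ => ((occurrences x w n : ℝ) - hits x w n) / n) atTop (𝓝 0) := by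
    refine squeeze_zero_norm (fun n => ?_)
      (tendsto_const_div_atTop_nhds_zero_nat ((w.length : ℝ) + 1))
    rw [norm_div, Real.norm_natCast]
    gcongr
    have := abs_occurrences_sub_hits_le x w n
    rw [Real.norm_eq_abs]
    exact_mod_cast this
  have h2 := Tendsto.sub h h1
  rw [sub_zero] at h2
  refine h2.congr fun n => ?_
  rw [← sub_div]
  congr 1
  ring

/-- If the frequency of `w` is the same for all points of `Z`, then every invariant probability
measure on `Z` gives this frequency as the measure of the cylinder set of `w`. -/
theorem measureReal_cylinder_eq {Z : Set BiSeq} {w : List Letter} {f : ℝ}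
    (hf : ∀ x ∈ Z, HasFrequency x w f) {μ : Measure BiSeq}
    (hμ : μ ∈ invariantProbabilityMeasures Z) : μ.real (cylinder w) = f := by
  obtain ⟨hp, hZ, hinv⟩ := hμ
  have hmeas : ∀ i, MeasurableSet (shift^[i] ⁻¹' cylinder w) := fun i =>
    (hinv.iterate i).measurable (measurableSet_cylinder w)
  have hint : ∀ i, Integrable ((shift^[i] ⁻¹' cylinder w).indicator (fun _ => (1 : ℝ))) μ :=
    fun i => (integrable_const 1).indicator (hmeas i)
  -- By invariance each indicator has the same integral. The quotient is left unreduced so that the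
  -- identity also holds at `n = 0`.
  have hI : ∀ n : ℕ, ∫ x, (hits x w n : ℝ) / n ∂μ = n * μ.real (cylinder w) / n := fun n => by
    rw [integral_div]
    congr 1
    simp only [hits_eq_sum_indicator]
    rw [integral_finsetSum _ fun i _ => hint i]
    have : ∀ i ∈ Finset.range n, ∫ x, (shift^[i] ⁻¹' cylinder w).indicator (fun _ => (1 : ℝ)) x ∂μ =
        μ.real (cylinder w) := fun i _ => by
      rw [integral_indicator (hmeas i), setIntegral_const, smul_eq_mul, mul_one, Measure.real,
        (hinv.iterate i).measure_preimage (measurableSet_cylinder w).nullMeasurableSet, Measure.real]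
    rw [Finset.sum_congr rfl this]
    simp
  have hlim : Tendsto (fun n : ℕ => ∫ x, (hits x w n : ℝ) / n ∂μ) atTop (𝓝 (∫ _, f ∂μ)) := by
    refine tendsto_integral_of_dominated_convergence (fun _ => 1) (fun n => ?_)
      (integrable_const 1) (fun n => ae_of_all _ fun x => ?_) ?_
    · simp only [hits_eq_sum_indicator]
      exact ((integrable_finsetSum _ fun i _ => hint i).div_const _).aestronglyMeasurable
    · have := hits_sub_mem x w (Int.natCast_nonneg n)
      rw [hits_zero, sub_zero, sub_zero] at this
      have h1 : (0 : ℝ) ≤ hits x w n := by exact_mod_cast this.1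
      have h2 : (hits x w n : ℝ) ≤ n := by exact_mod_cast this.2
      rw [Real.norm_of_nonneg (by positivity)]
      exact div_le_one_of_le₀ h2 (Nat.cast_nonneg n)
    · have : ∀ᵐ x ∂μ, x ∈ Z := hZ
      filter_upwards [this] with x hx using (hf x hx).tendsto_hits
  rw [integral_const, probReal_univ, one_smul] at hlim
  refine tendsto_nhds_unique (tendsto_const_nhds.congr' ?_) hlim
  filter_upwards [eventually_gt_atTop 0] with n hn
  rw [hI]
  have : (n : ℝ) ≠ 0 := by positivity
  field_simp

/-- The sequences which agree with `v` on `[-K, K]`. -/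
def window (K : ℕ) (v : BiSeq) : Set BiSeq := {x | ∀ i : ℤ, i.natAbs ≤ K → x i = v i}

theorem isOpen_window (K : ℕ) (v : BiSeq) : IsOpen (window K v) := by
  have : window K v = (Finset.Icc (-(K : ℤ)) K : Set ℤ).pi fun i => {v i} := by
    ext x
    simp only [window, Set.mem_ofPred_eq, Set.mem_pi, Finset.coe_Icc, Set.mem_Icc,
      Set.mem_singleton_iff]
    exact forall_congr' fun i => imp_congr_left (by omega)
  rw [this]
  exact isOpen_set_pi (Finset.finite_toSet _) fun i _ => isOpen_discrete _

theorem isPiSystem_windows : IsPiSystem {s | ∃ K v, s = window K v} := by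
  rintro _ ⟨K, v, rfl⟩ _ ⟨K', v', rfl⟩ ⟨z, hz, hz'⟩
  refine ⟨max K K', z, ?_⟩
  ext x
  constructor
  · rintro ⟨h, h'⟩ i hi
    rcases le_max_iff.1 hi with hi | hi
    · rw [h i hi, hz i hi]
    · rw [h' i hi, hz' i hi]
  · intro h
    exact ⟨fun i hi => by rw [h i (le_max_of_le_left hi), hz i hi],
      fun i hi => by rw [h i (le_max_of_le_right hi), hz' i hi]⟩

theorem isTopologicalBasis_windows :
    TopologicalSpace.IsTopologicalBasis {s | ∃ K v, s = window K v} := by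
  refine TopologicalSpace.isTopologicalBasis_of_isOpen_of_nhds ?_ fun x u hx hu => ?_
  · rintro _ ⟨K, v, rfl⟩
    exact isOpen_window K v
  · obtain ⟨I, U, hI, hsub⟩ := isOpen_pi_iff.1 hu x hx
    refine ⟨_, ⟨I.sup Int.natAbs, x, rfl⟩, fun i _ => rfl, fun y hy => hsub fun i hi => ?_⟩
    rw [hy i (Finset.le_sup (f := Int.natAbs) hi)]
    exact (hI i hi).2

theorem shift_iterate_preimage_window (K : ℕ) (v : BiSeq) : shift^[K] ⁻¹' window K v =
    cylinder (List.ofFn fun k : Fin (2 * K + 1) => v ((k : ℤ) - K)) := by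
  ext x
  simp only [window, cylinder, Set.mem_preimage, Set.mem_ofPred_eq, shift_iterate_apply,
    List.length_ofFn, List.getElem_ofFn]
  constructor
  · intro h i hi
    have := h (i - K) (by omega)
    rwa [sub_add_cancel] at this
  · intro h i hi
    have := h (i + K).toNat (by omega)
    rwa [Int.toNat_of_nonneg (by omega), add_sub_cancel_right] at this

/-- Cylinders only constrain nonnegative coordinates. By invariance a two-sided window may be pulled
back to a cylinder without changing its measure, and windows form a π-system generating the Borel
sets. -/
theorem invariantMeasure_ext {Z Z' : Set BiSeq} {μ ν : Measure BiSeq}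
    (hμ : μ ∈ invariantProbabilityMeasures Z) (hν : ν ∈ invariantProbabilityMeasures Z')
    (h : ∀ w, μ.real (cylinder w) = ν.real (cylinder w)) : μ = ν := by
  obtain ⟨hp, -, hinv⟩ := hμ
  obtain ⟨hp', -, hinv'⟩ := hν
  refine ext_of_generate_finite {s | ∃ K v, s = window K v} ?_ isPiSystem_windows ?_ (by simp)
  · rw [BorelSpace.measurable_eq (α := BiSeq), isTopologicalBasis_windows.borel_eq_generateFrom]
  · rintro _ ⟨K, v, rfl⟩
    have hm := (isOpen_window K v).measurableSet.nullMeasurableSet (μ := μ)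
    have hm' := (isOpen_window K v).measurableSet.nullMeasurableSet (μ := ν)
    rw [← (hinv.iterate K).measure_preimage hm, ← (hinv'.iterate K).measure_preimage hm',
      shift_iterate_preimage_window]
    exact (measureReal_eq_measureReal_iff).1 (h _)

theorem nonempty_invariantProbabilityMeasures {Z : Set BiSeq} (hne : Z.Nonempty)
    (hc : IsCompact Z) (hS : Set.MapsTo shift Z Z) : (invariantProbabilityMeasures Z).Nonempty := by
  have : Nonempty Z := hne.to_subtype
  have : CompactSpace Z := isCompact_iff_compactSpace.1 hc
  obtain ⟨ν, hν, hinv⟩ :=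
    exists_invariant_probabilityMeasure (continuous_shift.restrict hS)
  refine ⟨ν.map Subtype.val, Measure.isProbabilityMeasure_map measurable_subtype_coe.aemeasurable,
    ?_, continuous_shift.measurable, ?_⟩
  · rw [Measure.map_apply measurable_subtype_coe hc.isClosed.measurableSet.compl]
    simp
  · rw [Measure.map_map continuous_shift.measurable measurable_subtype_coe]
    conv_rhs => rw [← hinv.map_eq, Measure.map_map measurable_subtype_coe hinv.measurable]
    rfl

end SmoothSeq

theorem mainTheorem1 :
    (∀ τ : ℕ → Fin 2,
      SmoothSeq.IsSubshift (SmoothSeq.Xtype τ) ∧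
      ∃ μ : MeasureTheory.Measure SmoothSeq.BiSeq,
        SmoothSeq.invariantProbabilityMeasures (SmoothSeq.Xtype τ) = {μ} ∧
        ∀ x ∈ SmoothSeq.Xtype τ, ∀ w : List SmoothSeq.Letter,
          SmoothSeq.HasFrequency x w (μ.real (SmoothSeq.cylinder w))) ∧
    SmoothSeq.X = ⋃ τ : ℕ → Fin 2, SmoothSeq.Xtype τ ∧
    Pairwise (fun τ τ' : ℕ → Fin 2 => Disjoint (SmoothSeq.Xtype τ) (SmoothSeq.Xtype τ')) := by
  refine ⟨fun τ => ⟨SmoothSeq.isSubshift_Xtype τ, ?_⟩, SmoothSeq.X_eq_iUnion_Xtype,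
    SmoothSeq.pairwise_disjoint_Xtype⟩
  choose f hf using SmoothSeq.exists_hasFrequency τ
  obtain ⟨μ, hμ⟩ := SmoothSeq.nonempty_invariantProbabilityMeasures (SmoothSeq.nonempty_Xtype τ)
    (SmoothSeq.isCompact_Xtype τ) fun _ => SmoothSeq.shift_mem_Xtype
  have hval : ∀ ν ∈ SmoothSeq.invariantProbabilityMeasures (SmoothSeq.Xtype τ), ∀ w,
      ν.real (SmoothSeq.cylinder w) = f w := fun ν hν w => SmoothSeq.measureReal_cylinder_eq (hf w) hν
  refine ⟨μ, Set.eq_singleton_iff_unique_mem.2 ⟨hμ, fun ν hν =>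
    SmoothSeq.invariantMeasure_ext hν hμ fun w => by rw [hval ν hν, hval μ hμ]⟩, fun x hx w => ?_⟩
  rw [hval μ hμ]
  exact hf w x hx
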